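/- Let $m\ge 1$ and work with tempered distributions on $\mathbb{R}^m$. Let $\sigma_m$ be the area of the unit sphere $S^{m-1}$, let $\Sigma^{(0)}[\varphi](r)=\frac1{\sigma_m}\int_{S^{m-1}}\varphi(r\omega)\,dS(\omega)$ be the spherical mean, and for $\lambda\in\mathbb{C}$ let $T_\lambda=\mathrm{Fp}\,r^\lambda$ be given by $\langle T_\lambda,\varphi\rangle=\sigma_m\langle \mathrm{Fp}\,r_+^{\lambda+m-1},\Sigma^{(0)}[\varphi]\rangle$, where $\mathrm{Fp}$ is Hadamard's finite part. Put $$T^*_\lambda=\pi^{\frac{\lambda+m}2}\frac{T_\lambda}{\Gamma(\frac{\lambda+m}2)}\quad(\lambda\ne -m-2l),\qquad T^*_{-m-2l}=\frac{\pi^{\frac m2-l}}{2^{2l}\,\Gamma(\frac m2+l)}(-\Delta_m)^l\delta\quad(l=0,1,2,\dots),$$ and, for $\beta\in\mathbb{C}$ different from the exceptional values $-\frac m2-n$, $n=0,1,2,\dots$, $$(-\Delta_m)^\beta\delta=2^{2\beta}\,\frac{\Gamma(\frac{m+2\beta}2)}{\pi^{\frac{m-2\beta}2}}\,T^*_{-m-2\beta}.$$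 **Proposition.** For all $\alpha,\beta\in\mathbb{C}$ such that $\alpha$, $\beta$ and $\alpha+\beta$ are different from $-\frac m2-n$, $n=0,1,2,\dots$, one has $$(-\Delta_m)^\alpha\delta\ast(-\Delta_m)^\beta\delta=(-\Delta_m)^{\alpha+\beta}\delta .$$ Here the convolution is understood as follows. Two tempered distributions $S,T$ are convolvable with convolution $W$ if for all Schwartz functions $\varphi,\psi$ the function $x\mapsto\langle S,\varphi(\cdot-x)\rangle\,\langle T,\psi(\cdot+x)\rangle$ is integrable on $\mathbb{R}^m$ with integral $\langle W,\varphi\ast\psi\rangle$. If $\mathrm{Re}(\alpha+\beta)>-\frac m2$, or $\alpha\in\{0,1,2,\dots\}$, or $\beta\in\{0,1,2,\dots\}$, then the two kernels are convolvable and the identity holds in this sense. In general the convolution is defined by analytic continuation: the set $\Omega\subset\mathbb{C}^2$ of all admissible pairs $(\alpha,\beta)$ is open and connected, the kernels are convolvable for all $(\alpha,\beta)$ in a non-empty open subset of $\Omega$, and $(\alpha,\beta)\mapsto(-\Delta_m)^{\alpha+\beta}\delta$ is weakly holomorphic on $\Omega$ and equals $(-\Delta_m)^\alpha\delta\ast(-\Delta_m)^\beta\delta$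 at every $(\alpha,\beta)\in\Omega$ for which the two kernels are convolvable. -/

import Mathlib

noncomputable section

namespace RieszKernel

open MeasureTheory Set
open scoped SchwartzMap Laplacian

/-- The Euclidean space `ℝ^m`. -/
abbrev Eu (m : ℕ) : Type := EuclideanSpace ℝ (Fin m)

/-- The surface measure `dS` on the unit sphere of `ℝ^m`. -/
abbrev surf (m : ℕ) : Measure (Metric.sphere (0 : Eu m) 1) :=
  (volume : Measure (Eu m)).toSphere

/-- The area `σ_m` of the unit sphere of `ℝ^m`. -/
def sphereArea (m : ℕ) : ℝ := (surf m).real univ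

/-- The spherical mean `Σ⁰[φ](r) = σ_m⁻¹ ∫_{S^{m-1}} φ(rω) dS(ω)`, as a function of `r ∈ ℝ`. -/
def sphericalMean {m : ℕ} (φ : 𝓢(Eu m, ℂ)) (r : ℝ) : ℂ :=
  ((sphereArea m : ℝ) : ℂ)⁻¹ * ∫ ω, φ (r • (ω : Eu m)) ∂(surf m)

/-- The `k`-th Taylor coefficient of `ψ` at `0`. -/
def taylorCoeff (ψ : ℝ → ℂ) (k : ℕ) : ℂ := iteratedDeriv k ψ 0 / (Nat.factorial k : ℂ)

/-- The action `⟨Fp r₊^μ, ψ⟩` of Hadamard's finite part distribution `Fp r₊^μ` on `ψ`: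
the finite part of `∫_ε^∞ r^μ ψ(r) dr` as `ε → 0+`. On `(0, 1)` sufficiently many terms of the
Taylor expansion of `ψ` at `0` are subtracted, and the finite part of `∫_ε^1 r^(μ+k) dr` is
`1 / (μ+k+1)` if `μ+k+1 ≠ 0` and is `0` (the finite part of `-log ε`) if `μ+k+1 = 0`; the latter
value is also the one that Lean gives to the quotient. -/
def finitePart (μ : ℂ) (ψ : ℝ → ℂ) : ℂ :=
  (∫ r in Ioc (0 : ℝ) 1,
      (r : ℂ) ^ μ * (ψ r - ∑ k ∈ Finset.range ⌈-μ.re⌉₊, taylorCoeff ψ k * (r : ℂ) ^ k))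
    + ∑ k ∈ Finset.range ⌈-μ.re⌉₊, taylorCoeff ψ k / (μ + k + 1)
    + ∫ r in Ioi (1 : ℝ), (r : ℂ) ^ μ * ψ r

/-- The action of `T_λ = Fp r^λ` on a test function:
`⟨T_λ, φ⟩ = σ_m ⟨Fp r₊^(λ+m-1), Σ⁰[φ]⟩`. -/
def radialPairing {m : ℕ} (l : ℂ) (φ : 𝓢(Eu m, ℂ)) : ℂ :=
  (sphereArea m : ℂ) * finitePart (l + m - 1) (sphericalMean φ)

/-! The functional `T_λ` is linear and continuous, that is, a tempered distribution. -/

/-- The integral over the sphere of the `k`-th derivative of `r ↦ φ(rω)`. -/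
def rayDeriv {m : ℕ} (k : ℕ) (φ : 𝓢(Eu m, ℂ)) (r : ℝ) : ℂ :=
  ∫ ω : Metric.sphere (0 : Eu m) 1, iteratedDeriv k (fun t : ℝ => φ (t • (ω : Eu m))) r ∂(surf m)

theorem contDiff_ray {m : ℕ} (φ : 𝓢(Eu m, ℂ)) (v : Eu m) (n : ℕ) :
    ContDiff ℝ n (fun t : ℝ => φ (t • v)) := by
  have := φ.smooth n
  fun_prop

theorem iteratedDeriv_ray {m : ℕ} (φ : 𝓢(Eu m, ℂ)) (v : Eu m) (k : ℕ) (r : ℝ) :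
    iteratedDeriv k (fun t : ℝ => φ (t • v)) r = iteratedFDeriv ℝ k φ (r • v) (fun _ => v) := by
  have h := ContinuousLinearMap.iteratedFDeriv_comp_right (ContinuousLinearMap.toSpanSingleton ℝ v)
    (φ.smooth k) r (i := k) le_rfl
  have e : (φ ∘ (ContinuousLinearMap.toSpanSingleton ℝ v)) = fun t : ℝ => φ (t • v) := by
    ext t; simp
  rw [e] at h
  rw [iteratedDeriv_eq_iteratedFDeriv, h]
  simp

theorem norm_iteratedDeriv_ray_le {m : ℕ} (φ : 𝓢(Eu m, ℂ)) (ω : Metric.sphere (0 : Eu m) 1)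
    (k : ℕ) (r : ℝ) :
    ‖iteratedDeriv k (fun t : ℝ => φ (t • (ω : Eu m))) r‖ ≤ SchwartzMap.seminorm ℂ 0 k φ := by
  rw [iteratedDeriv_ray]
  refine (ContinuousMultilinearMap.le_opNorm _ _).trans ?_
  simpa using SchwartzMap.norm_iteratedFDeriv_le_seminorm ℂ φ k (r • (ω : Eu m))

theorem continuous_iteratedDeriv_ray {m : ℕ} (φ : 𝓢(Eu m, ℂ)) (k : ℕ) (r : ℝ) :
    Continuous (fun ω : Metric.sphere (0 : Eu m) 1 =>
      iteratedDeriv k (fun t : ℝ => φ (t • (ω : Eu m))) r) := by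
  simp_rw [iteratedDeriv_ray]
  have h : Continuous (iteratedFDeriv ℝ k φ) :=
    (φ.smooth k).continuous_iteratedFDeriv le_rfl
  have h2 : Continuous (fun ω : Metric.sphere (0 : Eu m) 1 =>
      iteratedFDeriv ℝ k φ (r • (ω : Eu m))) := h.comp (by fun_prop)
  have h3 : Continuous (fun ω : Metric.sphere (0 : Eu m) 1 =>
      (fun _ : Fin k => (ω : Eu m))) := by fun_prop
  exact continuous_eval.comp (h2.prodMk h3)

theorem integrable_iteratedDeriv_ray {m : ℕ} (φ : 𝓢(Eu m, ℂ)) (k : ℕ) (r : ℝ) :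
    Integrable (fun ω : Metric.sphere (0 : Eu m) 1 =>
      iteratedDeriv k (fun t : ℝ => φ (t • (ω : Eu m))) r) (surf m) :=
  Integrable.of_bound (continuous_iteratedDeriv_ray φ k r).aestronglyMeasurable
    (SchwartzMap.seminorm ℂ 0 k φ) (.of_forall fun ω => norm_iteratedDeriv_ray_le φ ω k r)

theorem hasDerivAt_rayDeriv {m : ℕ} (φ : 𝓢(Eu m, ℂ)) (k : ℕ) (r : ℝ) :
    HasDerivAt (rayDeriv k φ) (rayDeriv (k + 1) φ r) r := by
  refine (hasDerivAt_integral_of_dominated_loc_of_deriv_le (s := univ) (μ := surf m)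
    (F := fun r ω => iteratedDeriv k (fun t : ℝ => φ (t • (ω : Eu m))) r)
    (F' := fun r ω => iteratedDeriv (k + 1) (fun t : ℝ => φ (t • (ω : Eu m))) r)
    (bound := fun _ => SchwartzMap.seminorm ℂ 0 (k + 1) φ) Filter.univ_mem
    (.of_forall fun r => (continuous_iteratedDeriv_ray φ k r).aestronglyMeasurable)
    (integrable_iteratedDeriv_ray φ k r)
    (continuous_iteratedDeriv_ray φ (k + 1) r).aestronglyMeasurable
    (.of_forall fun ω r _ => norm_iteratedDeriv_ray_le φ ω (k + 1) r)
    (integrable_const _) (.of_forall fun ω r _ => ?_)).2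
  have h : Differentiable ℝ (iteratedDeriv k (fun t : ℝ => φ (t • (ω : Eu m)))) :=
    (contDiff_ray φ ω (k + 1)).differentiable_iteratedDeriv k (by exact_mod_cast Nat.lt_succ_self k)
  rw [iteratedDeriv_succ]
  exact (h r).hasDerivAt

theorem norm_rayDeriv_le {m : ℕ} (φ : 𝓢(Eu m, ℂ)) (k : ℕ) (r : ℝ) :
    ‖rayDeriv k φ r‖ ≤ SchwartzMap.seminorm ℂ 0 k φ * (surf m).real univ :=
  norm_integral_le_of_norm_le_const (.of_forall fun ω => norm_iteratedDeriv_ray_le φ ω k r)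

theorem continuous_rayDeriv {m : ℕ} (φ : 𝓢(Eu m, ℂ)) (k : ℕ) : Continuous (rayDeriv k φ) :=
  continuous_iff_continuousAt.2 fun r => (hasDerivAt_rayDeriv φ k r).continuousAt

theorem iteratedDeriv_sphericalMean {m : ℕ} (φ : 𝓢(Eu m, ℂ)) (k : ℕ) :
    iteratedDeriv k (sphericalMean φ) =
      fun r => ((sphereArea m : ℝ) : ℂ)⁻¹ * rayDeriv k φ r := by
  induction k with
  | zero => ext r; simp [sphericalMean, rayDeriv]
  | succ k ih =>
    ext r
    rw [iteratedDeriv_succ, ih]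
    exact ((hasDerivAt_rayDeriv φ k r).const_mul _).deriv

theorem rayDeriv_add {m : ℕ} (k : ℕ) (φ χ : 𝓢(Eu m, ℂ)) (r : ℝ) :
    rayDeriv k (φ + χ) r = rayDeriv k φ r + rayDeriv k χ r := by
  unfold rayDeriv
  rw [← integral_add (integrable_iteratedDeriv_ray φ k r) (integrable_iteratedDeriv_ray χ k r)]
  congr 1
  ext ω
  exact iteratedDeriv_fun_add (contDiff_ray φ ω k).contDiffAt (contDiff_ray χ ω k).contDiffAt

theorem rayDeriv_smul {m : ℕ} (k : ℕ) (c : ℂ) (φ : 𝓢(Eu m, ℂ)) (r : ℝ) :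
    rayDeriv k (c • φ) r = c * rayDeriv k φ r := by
  unfold rayDeriv
  rw [← integral_const_mul]
  congr 1
  ext ω
  have := iteratedDeriv_ray (c • φ) (ω : Eu m) k r
  rw [this, iteratedDeriv_ray]
  have h : iteratedFDeriv ℝ k (c • (φ : Eu m → ℂ)) (r • (ω : Eu m)) =
      c • iteratedFDeriv ℝ k φ (r • (ω : Eu m)) :=
    iteratedFDeriv_const_smul_apply (φ.smooth k).contDiffAt
  have h2 : ((c • φ : 𝓢(Eu m, ℂ)) : Eu m → ℂ) = c • (φ : Eu m → ℂ) := rfl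
  rw [h2, h]
  simp

/-- The Taylor remainder of order `N` of `rayDeriv j φ` at `0`. -/
def rayRem {m : ℕ} (N j : ℕ) (φ : 𝓢(Eu m, ℂ)) (r : ℝ) : ℂ :=
  rayDeriv j φ r - ∑ k ∈ Finset.range N, rayDeriv (j + k) φ 0 / (Nat.factorial k : ℂ) * (r : ℂ) ^ k

theorem continuous_rayRem {m : ℕ} (N j : ℕ) (φ : 𝓢(Eu m, ℂ)) : Continuous (rayRem N j φ) := by
  have := continuous_rayDeriv φ j
  unfold rayRem
  fun_prop

theorem hasDerivAt_rayRem {m : ℕ} (N j : ℕ) (φ : 𝓢(Eu m, ℂ)) (r : ℝ) :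
    HasDerivAt (rayRem (N + 1) j φ) (rayRem N (j + 1) φ r) r := by
  refine (hasDerivAt_rayDeriv φ j r).sub ?_
  have e : (fun r : ℝ => ∑ k ∈ Finset.range (N + 1),
      rayDeriv (j + k) φ 0 / (Nat.factorial k : ℂ) * (r : ℂ) ^ k) = fun r : ℝ =>
      ∑ k ∈ Finset.range N, rayDeriv (j + 1 + k) φ 0 / (Nat.factorial (k + 1) : ℂ) * (r : ℂ) ^ (k + 1)
        + rayDeriv j φ 0 := by
    ext r
    rw [Finset.sum_range_succ']
    simp [add_comm, add_left_comm]
  rw [e]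
  refine HasDerivAt.add_const _ (HasDerivAt.fun_sum fun k _ => ?_)
  have h : HasDerivAt (fun r : ℝ => (r : ℂ) ^ (k + 1)) (((k + 1 : ℕ) : ℂ) * (r : ℂ) ^ k) r := by
    have h3 := (hasDerivAt_pow (k + 1) (r : ℂ)).comp_ofReal
    simpa using h3
  refine (h.const_mul _).congr_deriv ?_
  have h1 : ((k + 1 : ℕ) : ℂ) ≠ 0 := by exact_mod_cast Nat.succ_ne_zero k
  have h2 : (Nat.factorial k : ℂ) ≠ 0 := by exact_mod_cast Nat.factorial_ne_zero k
  rw [Nat.factorial_succ]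
  push_cast at h1 ⊢
  field_simp

theorem norm_rayRem_le {m : ℕ} (φ : 𝓢(Eu m, ℂ)) (N : ℕ) : ∀ (j : ℕ) (r : ℝ), 0 ≤ r →
    ‖rayRem N j φ r‖ ≤ SchwartzMap.seminorm ℂ 0 (j + N) φ * (surf m).real univ * r ^ N := by
  induction N with
  | zero => intro j r _; simpa [rayRem] using norm_rayDeriv_le φ j r
  | succ N ih =>
    intro j r hr
    have h0 : rayRem (N + 1) j φ 0 = 0 := by
      simp [rayRem, Finset.sum_range_succ']
    have hC : 0 ≤ SchwartzMap.seminorm ℂ 0 (j + 1 + N) φ * (surf m).real univ := by positivity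
    have := norm_image_sub_le_of_norm_deriv_le_segment' (a := 0) (b := r)
      (f := rayRem (N + 1) j φ) (f' := rayRem N (j + 1) φ)
      (C := SchwartzMap.seminorm ℂ 0 (j + 1 + N) φ * (surf m).real univ * r ^ N)
      (fun x _ => (hasDerivAt_rayRem N j φ x).hasDerivWithinAt)
      (fun x hx => (ih (j + 1) x hx.1).trans (by gcongr; exacts [hx.1, hx.2.le])) r ⟨hr, le_rfl⟩
    rw [h0, sub_zero, sub_zero] at this
    have e : j + (N + 1) = j + 1 + N := by ring
    rw [e, pow_succ, ← mul_assoc]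
    exact this

theorem norm_near_le {m : ℕ} (μ : ℂ) (φ : 𝓢(Eu m, ℂ)) {r : ℝ} (hr : r ∈ Ioc (0 : ℝ) 1) :
    ‖(r : ℂ) ^ μ * rayRem ⌈-μ.re⌉₊ 0 φ r‖ ≤
      SchwartzMap.seminorm ℂ 0 ⌈-μ.re⌉₊ φ * (surf m).real univ := by
  have h := norm_rayRem_le φ ⌈-μ.re⌉₊ 0 r hr.1.le
  rw [zero_add] at h
  rw [norm_mul, Complex.norm_cpow_eq_rpow_re_of_pos hr.1]
  have h1 : r ^ μ.re * r ^ ⌈-μ.re⌉₊ ≤ 1 := by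
    rw [← Real.rpow_natCast, ← Real.rpow_add hr.1]
    exact Real.rpow_le_one hr.1.le hr.2 (by linarith [Nat.le_ceil (-μ.re)])
  have hC : 0 ≤ SchwartzMap.seminorm ℂ 0 ⌈-μ.re⌉₊ φ * (surf m).real univ := by positivity
  calc r ^ μ.re * ‖rayRem ⌈-μ.re⌉₊ 0 φ r‖
      ≤ r ^ μ.re * (SchwartzMap.seminorm ℂ 0 ⌈-μ.re⌉₊ φ * (surf m).real univ * r ^ ⌈-μ.re⌉₊) := by
        gcongr
        exact Real.rpow_nonneg hr.1.le _
    _ = SchwartzMap.seminorm ℂ 0 ⌈-μ.re⌉₊ φ * (surf m).real univ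
          * (r ^ μ.re * r ^ ⌈-μ.re⌉₊) := by ring
    _ ≤ _ := mul_le_of_le_one_right hC h1

theorem continuousOn_cpow_pos (μ : ℂ) : ContinuousOn (fun r : ℝ => (r : ℂ) ^ μ) (Ioi 0) :=
  fun r hr => (Complex.continuousAt_ofReal_cpow_const r μ (Or.inr (ne_of_gt hr))).continuousWithinAt

theorem integrableOn_near {m : ℕ} (μ : ℂ) (φ : 𝓢(Eu m, ℂ)) :
    IntegrableOn (fun r : ℝ => (r : ℂ) ^ μ * rayRem ⌈-μ.re⌉₊ 0 φ r) (Ioc 0 1) := by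
  refine IntegrableOn.of_bound (C := SchwartzMap.seminorm ℂ 0 ⌈-μ.re⌉₊ φ *
    (surf m).real univ) (by simp) ?_ ?_
  · exact (((continuousOn_cpow_pos μ).mono Ioc_subset_Ioi_self).mul
      (continuous_rayRem _ _ φ).continuousOn).aestronglyMeasurable measurableSet_Ioc
  · exact (ae_restrict_iff' measurableSet_Ioc).2 (.of_forall fun r hr => norm_near_le μ φ hr)

/-- The part of the finite part over `(0, 1)`, as a continuous functional. -/
def nearCLM (m : ℕ) (μ : ℂ) : 𝓢(Eu m, ℂ) →L[ℂ] ℂ :=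
  SchwartzMap.mkCLMtoNormedSpace
    (fun φ => ∫ r in Ioc (0 : ℝ) 1, (r : ℂ) ^ μ * rayRem ⌈-μ.re⌉₊ 0 φ r)
    (fun φ χ => by
      rw [← integral_add (integrableOn_near μ φ) (integrableOn_near μ χ)]
      congr 1
      ext r
      simp only [rayRem, rayDeriv_add, add_div, add_mul, Finset.sum_add_distrib]
      ring)
    (fun c φ => by
      rw [RingHom.id_apply, smul_eq_mul, ← integral_const_mul]
      congr 1
      ext r
      simp only [rayRem, rayDeriv_smul, mul_div_assoc, mul_assoc, ← Finset.mul_sum]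
      ring)
    ⟨{(0, ⌈-μ.re⌉₊)}, (surf m).real univ, by positivity, fun φ => by
      have := norm_setIntegral_le_of_norm_le_const (μ := volume) (s := Ioc (0 : ℝ) 1) (by simp)
        (fun r hr => norm_near_le μ φ hr)
      simpa [mul_comm] using this⟩

theorem norm_far_le {m : ℕ} (μ : ℂ) (φ : 𝓢(Eu m, ℂ)) {r : ℝ} (hr : r ∈ Ioi (1 : ℝ)) :
    ‖(r : ℂ) ^ μ * rayDeriv 0 φ r‖ ≤
      SchwartzMap.seminorm ℂ (⌈μ.re⌉₊ + 2) 0 φ * (surf m).real univ * r ^ (-2 : ℝ) := by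
  have hr0 : 0 < r := lt_trans one_pos hr
  have hb : ‖rayDeriv 0 φ r‖ ≤
      SchwartzMap.seminorm ℂ (⌈μ.re⌉₊ + 2) 0 φ / r ^ (⌈μ.re⌉₊ + 2) * (surf m).real univ := by
    refine norm_integral_le_of_norm_le_const (.of_forall fun ω => ?_)
    have h := SchwartzMap.norm_pow_mul_le_seminorm ℂ φ (⌈μ.re⌉₊ + 2) (r • (ω : Eu m))
    rw [norm_smul, norm_eq_of_mem_sphere, mul_one, Real.norm_of_nonneg hr0.le] at h
    rw [le_div_iff₀ (by positivity), mul_comm]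
    simpa using h
  have h1 : r ^ μ.re / r ^ (⌈μ.re⌉₊ + 2) ≤ r ^ (-2 : ℝ) := by
    rw [← Real.rpow_natCast, ← Real.rpow_sub hr0]
    refine Real.rpow_le_rpow_of_exponent_le (le_of_lt hr) ?_
    push_cast
    linarith [Nat.le_ceil μ.re]
  rw [norm_mul, Complex.norm_cpow_eq_rpow_re_of_pos hr0]
  have hC : 0 ≤ SchwartzMap.seminorm ℂ (⌈μ.re⌉₊ + 2) 0 φ * (surf m).real univ := by positivity
  calc r ^ μ.re * ‖rayDeriv 0 φ r‖
      ≤ r ^ μ.re * (SchwartzMap.seminorm ℂ (⌈μ.re⌉₊ + 2) 0 φ / r ^ (⌈μ.re⌉₊ + 2) *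
          (surf m).real univ) := by gcongr
    _ = SchwartzMap.seminorm ℂ (⌈μ.re⌉₊ + 2) 0 φ * (surf m).real univ *
          (r ^ μ.re / r ^ (⌈μ.re⌉₊ + 2)) := by ring
    _ ≤ _ := by gcongr

theorem integrableOn_far {m : ℕ} (μ : ℂ) (φ : 𝓢(Eu m, ℂ)) :
    IntegrableOn (fun r : ℝ => (r : ℂ) ^ μ * rayDeriv 0 φ r) (Ioi 1) := by
  refine Integrable.mono' (g := fun r : ℝ => SchwartzMap.seminorm ℂ (⌈μ.re⌉₊ + 2) 0 φ *
    (surf m).real univ * r ^ (-2 : ℝ))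
    ((integrableOn_Ioi_rpow_of_lt (by norm_num) one_pos).const_mul _) ?_ ?_
  · exact (((continuousOn_cpow_pos μ).mono (Ioi_subset_Ioi zero_le_one)).mul
      (continuous_rayDeriv φ 0).continuousOn).aestronglyMeasurable measurableSet_Ioi
  · exact (ae_restrict_iff' measurableSet_Ioi).2 (.of_forall fun r hr => norm_far_le μ φ hr)

/-- The part of the finite part over `(1, ∞)`, as a continuous functional. -/
def farCLM (m : ℕ) (μ : ℂ) : 𝓢(Eu m, ℂ) →L[ℂ] ℂ :=
  SchwartzMap.mkCLMtoNormedSpace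
    (fun φ => ∫ r in Ioi (1 : ℝ), (r : ℂ) ^ μ * rayDeriv 0 φ r)
    (fun φ χ => by
      rw [← integral_add (integrableOn_far μ φ) (integrableOn_far μ χ)]
      simp only [rayDeriv_add, mul_add])
    (fun c φ => by
      rw [RingHom.id_apply, smul_eq_mul, ← integral_const_mul]
      simp only [rayDeriv_smul, mul_left_comm])
    ⟨{(⌈μ.re⌉₊ + 2, 0)}, (surf m).real univ, by positivity, fun φ => by
      have h := norm_integral_le_of_norm_le (μ := volume.restrict (Ioi (1 : ℝ)))
        ((integrableOn_Ioi_rpow_of_lt (by norm_num : (-2 : ℝ) < -1) one_pos).const_mul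
          (SchwartzMap.seminorm ℂ (⌈μ.re⌉₊ + 2) 0 φ * (surf m).real univ))
        ((ae_restrict_iff' measurableSet_Ioi).2 (.of_forall fun r hr => norm_far_le μ φ hr))
      rw [integral_const_mul, integral_Ioi_rpow_of_lt (by norm_num) one_pos] at h
      norm_num at h
      simpa [mul_comm] using h⟩

/-- A derivative at `0` of the integral over the sphere, as a continuous functional. -/
def rayCLM (m k : ℕ) : 𝓢(Eu m, ℂ) →L[ℂ] ℂ :=
  SchwartzMap.mkCLMtoNormedSpace (fun φ => rayDeriv k φ 0)
    (fun φ χ => rayDeriv_add k φ χ 0) (fun c φ => rayDeriv_smul k c φ 0)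
    ⟨{(0, k)}, (surf m).real univ, by positivity, fun φ => by
      simpa [mul_comm] using norm_rayDeriv_le φ k 0⟩

theorem radialPairing_eq {m : ℕ} (l : ℂ) (φ : 𝓢(Eu m, ℂ)) :
    radialPairing l φ = (((sphereArea m : ℂ) * ((sphereArea m : ℝ) : ℂ)⁻¹) •
      (nearCLM m (l + m - 1)
        + ∑ k ∈ Finset.range ⌈-(l + m - 1).re⌉₊, ((l + m - 1 + k + 1)⁻¹ / (Nat.factorial k : ℂ)) • rayCLM m k
        + farCLM m (l + m - 1))) φ := by
  have hn (μ : ℂ) : nearCLM m μ φ =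
    ∫ r in Ioc (0 : ℝ) 1, (r : ℂ) ^ μ * rayRem ⌈-μ.re⌉₊ 0 φ r := rfl
  have hf (μ : ℂ) : farCLM m μ φ =
    ∫ r in Ioi (1 : ℝ), (r : ℂ) ^ μ * rayDeriv 0 φ r := rfl
  have hr (k : ℕ) : rayCLM m k φ = rayDeriv k φ 0 := rfl
  have h0 (r : ℝ) : sphericalMean φ r = ((sphereArea m : ℝ) : ℂ)⁻¹ * rayDeriv 0 φ r := by
    simp [sphericalMean, rayDeriv]
  simp only [radialPairing, finitePart, taylorCoeff, iteratedDeriv_sphericalMean, h0,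
    smul_apply, add_apply, sum_apply,
    hn, hf, hr, smul_eq_mul]
  generalize l + m - 1 = μ
  generalize ((sphereArea m : ℝ) : ℂ) = s
  have e1 (r : ℝ) : (r : ℂ) ^ μ * (s⁻¹ * rayDeriv 0 φ r - ∑ k ∈ Finset.range ⌈-μ.re⌉₊,
      s⁻¹ * rayDeriv k φ 0 / (Nat.factorial k : ℂ) * (r : ℂ) ^ k)
      = s⁻¹ * ((r : ℂ) ^ μ * rayRem ⌈-μ.re⌉₊ 0 φ r) := by
    simp only [rayRem, zero_add, mul_div_assoc, mul_assoc, ← Finset.mul_sum]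
    ring
  have e2 (r : ℝ) : (r : ℂ) ^ μ * (s⁻¹ * rayDeriv 0 φ r)
      = s⁻¹ * ((r : ℂ) ^ μ * rayDeriv 0 φ r) := by ring
  have e3 : ∑ k ∈ Finset.range ⌈-μ.re⌉₊, s⁻¹ * rayDeriv k φ 0 / (Nat.factorial k : ℂ) / (μ + k + 1)
      = s⁻¹ * ∑ k ∈ Finset.range ⌈-μ.re⌉₊, (μ + k + 1)⁻¹ / (Nat.factorial k : ℂ) * rayDeriv k φ 0 := by
    rw [Finset.mul_sum]
    refine Finset.sum_congr rfl fun k _ => ?_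
    rw [div_eq_mul_inv _ (μ + k + 1)]
    ring
  simp only [e1, e2, e3, integral_const_mul]
  ring

theorem exists_radial_clm (m : ℕ) (l : ℂ) :
    ∃ L : 𝓢(Eu m, ℂ) →L[ℂ] ℂ, ⇑L = radialPairing l :=
  ⟨_, funext fun φ => (radialPairing_eq l φ).symm⟩

/-- The tempered distribution `T_λ = Fp r^λ` on `ℝ^m`. -/
def T (m : ℕ) (l : ℂ) : 𝓢'(Eu m, ℂ) :=
  ContinuousLinearMap.toPointwiseConvergenceCLM _ _ _ _
    { toFun := radialPairing l
      map_add' := by obtain ⟨L, hL⟩ := exists_radial_clm m l; rw [← hL]; exact L.map_add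
      map_smul' := by obtain ⟨L, hL⟩ := exists_radial_clm m l; rw [← hL]; exact L.map_smul
      cont := by obtain ⟨L, hL⟩ := exists_radial_clm m l; rw [← hL]; exact L.continuous }

theorem T_apply {m : ℕ} (l : ℂ) (φ : 𝓢(Eu m, ℂ)) : T m l φ = radialPairing l φ := rfl

/-- The distribution `(-Δ)^l δ`, for a natural number `l`. -/
def negLaplacianPowDelta (m l : ℕ) : 𝓢'(Eu m, ℂ) :=
  (fun S : 𝓢'(Eu m, ℂ) => -Δ S)^[l] (TemperedDistribution.delta 0)

open Classical in
/-- The normalized distribution `T*_λ`. It is `π^((λ+m)/2) T_λ / Γ((λ+m)/2)` unless `λ = -m-2l`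
for some `l = 0, 1, 2, …`, and `π^(m/2-l) / (2^(2l) Γ(m/2+l)) (-Δ)^l δ` in this latter case. -/
def Tstar (m : ℕ) (lam : ℂ) : 𝓢'(Eu m, ℂ) :=
  if h : ∃ l : ℕ, lam = -(m : ℂ) - 2 * l then
    ((Real.pi : ℂ) ^ ((m : ℂ) / 2 - h.choose) /
      (2 ^ (2 * h.choose) * Complex.Gamma ((m : ℂ) / 2 + h.choose))) •
        negLaplacianPowDelta m h.choose
  else
    ((Real.pi : ℂ) ^ ((lam + m) / 2) / Complex.Gamma ((lam + m) / 2)) • T m lam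

/-- The kernel `(-Δ_m)^β δ = 2^(2β) Γ((m+2β)/2) / π^((m-2β)/2) T*_{-m-2β}`. -/
def kernel (m : ℕ) (β : ℂ) : 𝓢'(Eu m, ℂ) :=
  ((2 : ℂ) ^ (2 * β) * Complex.Gamma ((m + 2 * β) / 2) / (Real.pi : ℂ) ^ ((m - 2 * β) / 2)) •
    Tstar m (-(m : ℂ) - 2 * β)

/-- `β` is none of the exceptional values `-m/2 - n`, `n = 0, 1, 2, …`. -/
def Admissible (m : ℕ) (β : ℂ) : Prop := ∀ n : ℕ, β ≠ -(m : ℂ) / 2 - n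

/-- The pairs `(α, β)` for which `α`, `β` and `α + β` are not exceptional. -/
def admissiblePairs (m : ℕ) : Set (ℂ × ℂ) :=
  {p | Admissible m p.1 ∧ Admissible m p.2 ∧ Admissible m (p.1 + p.2)}

/-- The tempered distributions `S` and `T` are convolvable (in the sense of Schwartz and
Shiraishi) and `W` is their convolution `S ∗ T`: for all test functions `φ` and `ψ` the product of
the smooth functions `x ↦ ⟨S, φ(· - x)⟩` and `x ↦ ⟨T, ψ(· + x)⟩` is integrable, and its integral,
formally `∫∫ S(y) T(z) (φ ∗ ψ)(y + z) dy dz`, is `⟨W, φ ∗ ψ⟩`. -/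
def IsConvolution {m : ℕ} (S T W : 𝓢'(Eu m, ℂ)) : Prop :=
  ∀ φ ψ : 𝓢(Eu m, ℂ),
    Integrable (fun x : Eu m =>
      S (SchwartzMap.compSubConstCLM ℂ x φ) * T (SchwartzMap.compSubConstCLM ℂ (-x) ψ)) ∧
    ∫ x : Eu m, S (SchwartzMap.compSubConstCLM ℂ x φ) * T (SchwartzMap.compSubConstCLM ℂ (-x) ψ) =
      W (SchwartzMap.convolution (ContinuousLinearMap.mul ℂ ℂ) φ ψ)

/-- The family `W` on the domain `Ω ⊆ ℂ²` is the convolution `S_α ∗ T_β` of the families `S` and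
`T` in the sense of analytic continuation: `Ω` is open and connected, `W` is (weakly) holomorphic
on `Ω`, `S_α` and `T_β` are convolvable for all `(α, β)` in a non-empty open part of `Ω`, and
`W(α, β) = S_α ∗ T_β` for all `(α, β) ∈ Ω` for which `S_α` and `T_β` are convolvable. By the
identity theorem there is at most one such `W` on `Ω`. -/
structure IsContinuedConvolution {m : ℕ} (Ω : Set (ℂ × ℂ)) (S T : ℂ → 𝓢'(Eu m, ℂ))
    (W : ℂ → ℂ → 𝓢'(Eu m, ℂ)) : Prop where
  isOpen : IsOpen Ω
  isConnected : IsConnected Ω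
  holomorphic : ∀ φ : 𝓢(Eu m, ℂ), DifferentiableOn ℂ (fun p : ℂ × ℂ => W p.1 p.2 φ) Ω
  convolvable : ∃ U ⊆ Ω, IsOpen U ∧ U.Nonempty ∧
    ∀ p ∈ U, ∃ V, IsConvolution (S p.1) (T p.2) V
  extends_convolution : ∀ p ∈ Ω, (∃ V, IsConvolution (S p.1) (T p.2) V) →
    IsConvolution (S p.1) (T p.2) (W p.1 p.2)

end RieszKernel

end

/-! Convolvability is a statement about the regularizations x ↦ ⟨(-Δ)^β δ, φ(· - x)⟩, and two
descriptions of them carry the proof.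

Fourier side: for Re β > -m/2 the kernel is φ ↦ ∫ (2π|ξ|)^(2β) φ̂(ξ) dξ
(`kernel_eq_fourierPairing`). Its regularization is then the Fourier transform of an integrable
function, and convolution reduces to (2π|ξ|)^(2α) (2π|ξ|)^(2β) = (2π|ξ|)^(2(α+β)). The formula is
proved in the strip -m/2 < Re β < 0, where both sides are absolutely convergent, by comparing Mellin
transforms of Gaussian pairings (`kernel_eq_fourierPairing_of_strip`). It extends to the half-plane
by the identity theorem and holds at β ∈ ℕ by Fourier inversion. Hence the points β ∈ ℕ, where the
kernel is defined separately, are not singular, and the kernel is weakly holomorphic at all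
admissible β (`differentiableOn_kernel`).

Space side: for admissible β ∉ ℕ the regularization is O((1+|x|)^(-m-2 Re β)), locally uniformly in
β (`exists_kernel_translate_le`). For β ∈ ℕ it is a Schwartz function.

The convolution identity follows from Fourier inversion when one regularization is integrable
(`integral_kernel_mul_kernel`). With α fixed, it is continued in β through the half-plane where the
decay keeps the product of the regularizations integrable (`isConvolution_of_decay`). If α ∈ ℕ this
half-plane can be made as large as desired.

Conversely, the decay rate is sharp on bump functions (`exists_le_norm_kernel_translate`). So for
non-natural exponents convolvability forces Re(α+β) > -m/2 (`re_add_gt_of_isConvolution`). The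
convolvable admissible pairs are therefore exactly those already treated, and the continuation
statement needs nothing further beyond openness, connectedness and holomorphy. -/

namespace RieszKernel

open MeasureTheory Set Filter Topology
open scoped SchwartzMap Laplacian

/-! ### Holomorphic dependence on a parameter and identity theorem -/

/-- An integral depending on a complex parameter is holomorphic if the integrand is holomorphic and
locally uniformly dominated. -/
theorem differentiableOn_integral_of_locally_dominated {X : Type*} [MeasurableSpace X]
    {μ : Measure X} {U : Set ℂ} (hU : IsOpen U) {f : ℂ → X → ℂ}
    (hm : ∀ z ∈ U, AEStronglyMeasurable (f z) μ)
    (hd : ∀ᵐ x ∂μ, DifferentiableOn ℂ (fun z => f z x) U)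
    (hb : ∀ z₀ ∈ U, ∃ r > 0, ∃ g : X → ℝ, Integrable g μ ∧
      ∀ᵐ x ∂μ, ∀ z ∈ Metric.ball z₀ r, ‖f z x‖ ≤ g x) :
    DifferentiableOn ℂ (fun z => ∫ x, f z x ∂μ) U := by
  intro z₀ hz₀
  obtain ⟨r₁, hr₁, g, hg, hfg⟩ := hb z₀ hz₀
  obtain ⟨r₂, hr₂, hball⟩ := Metric.isOpen_iff.1 hU z₀ hz₀
  set r := min r₁ r₂ with hr
  have hr0 : 0 < r := lt_min hr₁ hr₂
  have hsub : Metric.ball z₀ r ⊆ U := (Metric.ball_subset_ball (min_le_right _ _)).trans hball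
  -- Cauchy's estimate on discs of radius r/4 turns the bound on `f` into one on its derivative.
  have hd' : ∀ᵐ x ∂μ, ∀ z ∈ Metric.ball z₀ (r / 2),
      HasDerivAt (fun z => f z x) (deriv (fun z => f z x) z) z ∧
        ‖deriv (fun z => f z x) z‖ ≤ g x / (r / 4) := by
    filter_upwards [hd, hfg] with x hx hgx z hz
    rw [Metric.mem_ball] at hz
    have hcl : Metric.closedBall z (r / 4) ⊆ Metric.ball z₀ r := fun w hw => by
      rw [Metric.mem_closedBall] at hw
      rw [Metric.mem_ball]
      linarith [dist_triangle w z z₀]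
    refine ⟨(hx.differentiableAt (hU.mem_nhds (hsub (hcl (Metric.mem_closedBall_self
      (by positivity)))))).hasDerivAt, ?_⟩
    refine Complex.norm_deriv_le_of_forall_mem_sphere_norm_le (by positivity) ?_ fun w hw => ?_
    · refine DifferentiableOn.diffContOnCl ?_
      rw [closure_ball _ (by positivity)]
      exact hx.mono (hcl.trans hsub)
    · exact hgx w (Metric.ball_subset_ball (min_le_left _ _)
        (hcl (Metric.sphere_subset_closedBall hw)))
  have hseq : ∀ n : ℕ, z₀ + ((r / 2 / (n + 2) : ℝ) : ℂ) ∈ U := fun n => hsub (by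
    rw [Metric.mem_ball, dist_eq_norm, add_sub_cancel_left, Complex.norm_real,
      Real.norm_of_nonneg (by positivity), div_div, div_lt_iff₀ (by positivity)]
    nlinarith [(Nat.cast_nonneg n : (0 : ℝ) ≤ n)])
  -- The derivative is measurable as a limit of difference quotients along the steps r/(2(n+2)),
  -- which stay inside the ball.
  have hderivmeas : AEStronglyMeasurable (fun x => deriv (fun z => f z x) z₀) μ := by
    refine aestronglyMeasurable_of_tendsto_ae (u := atTop)
      (f := fun (n : ℕ) x => (((r / 2 / (n + 2) : ℝ) : ℂ))⁻¹ *
        (f (z₀ + ((r / 2 / (n + 2) : ℝ) : ℂ)) x - f z₀ x)) ?_ ?_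
    · exact fun n => ((hm _ (hseq n)).sub (hm _ hz₀)).const_mul _
    · filter_upwards [hd'] with x hx
      have h := (hx z₀ (Metric.mem_ball_self (by positivity))).1
      have ht := (hasDerivAt_iff_tendsto_slope_zero.1 h)
      have hlim : Tendsto (fun n : ℕ => ((r / 2 / (n + 2) : ℝ) : ℂ)) atTop (𝓝[≠] 0) := by
        refine tendsto_nhdsWithin_iff.2 ⟨?_, .of_forall fun n => ?_⟩
        · have h1 : Tendsto (fun n : ℕ => (n : ℝ) + 2) atTop atTop :=
            tendsto_atTop_add_const_right _ _ tendsto_natCast_atTop_atTop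
          have h2 : Tendsto (fun n : ℕ => r / 2 / ((n : ℝ) + 2)) atTop (𝓝 0) :=
            h1.const_div_atTop _
          have h3 := (Complex.continuous_ofReal.tendsto 0).comp h2
          rwa [Complex.ofReal_zero] at h3
        · have : (r / 2 / (n + 2) : ℝ) ≠ 0 := by positivity
          exact Complex.ofReal_ne_zero.2 this
      exact ht.comp hlim
  have hint : Integrable (f z₀) μ := by
    refine hg.mono' (hm z₀ hz₀) ?_
    filter_upwards [hfg] with x hx using hx z₀ (Metric.mem_ball_self hr₁)
  refine (hasDerivAt_integral_of_dominated_loc_of_deriv_le (F := f)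
    (F' := fun z x => deriv (fun z => f z x) z) (bound := fun x => g x / (r / 4))
    (Metric.ball_mem_nhds z₀ (half_pos hr0)) ?_ hint hderivmeas ?_ (hg.div_const _) ?_
    ).2.differentiableAt.differentiableWithinAt
  · filter_upwards [hU.mem_nhds hz₀] with z hz using hm z hz
  · filter_upwards [hd'] with x hx z hz using (hx z hz).2
  · filter_upwards [hd'] with x hx z hz using (hx z hz).1

/-- The map x + iy ↦ a + eˣ + iy is a continuous injection of ℂ onto the half-plane. The set is thus
the image of the complement of a countable subset of ℂ, which is connected because ℂ has real
dimension two. -/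
theorem isPreconnected_halfPlane_diff_countable (a : ℝ) {s : Set ℂ} (hs : s.Countable) :
    IsPreconnected ({z : ℂ | a < z.re} \ s) := by
  set e : ℂ → ℂ := fun z => ((a + Real.exp z.re : ℝ) : ℂ) + (z.im : ℂ) * Complex.I with he
  have hre (z : ℂ) : (e z).re = a + Real.exp z.re := by
    simp only [e, Complex.add_re, Complex.re_ofReal_mul, Complex.I_re, Complex.ofReal_re]; ring
  have him (z : ℂ) : (e z).im = z.im := by
    simp only [e, Complex.add_im, Complex.im_ofReal_mul, Complex.I_im, Complex.ofReal_im]; ring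
  have hinj : Function.Injective e := fun z w h => by
    refine Complex.ext ?_ ?_
    · have := congrArg Complex.re h
      rw [hre, hre] at this
      exact Real.exp_injective (by linarith)
    · simpa [him] using congrArg Complex.im h
  have hc : Continuous e := by fun_prop
  have himg : {z : ℂ | a < z.re} \ s = e '' (e ⁻¹' s)ᶜ := by
    ext w
    constructor
    · rintro ⟨hw, hws⟩
      have hw' : 0 < w.re - a := sub_pos.2 hw
      have hew : e (⟨Real.log (w.re - a), w.im⟩ : ℂ) = w := by
        refine Complex.ext ?_ ?_
        · rw [hre, Real.exp_log hw']; ring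
        · rw [him]
      exact ⟨_, by rw [mem_compl_iff, mem_preimage, hew]; exact hws, hew⟩
    · rintro ⟨z, hz, rfl⟩
      refine ⟨?_, hz⟩
      rw [mem_ofPred_eq, hre]
      linarith [Real.exp_pos z.re]
  rw [himg]
  refine IsPreconnected.image ?_ _ hc.continuousOn
  refine ((hs.preimage hinj).isConnected_compl_of_one_lt_rank ?_).isPreconnected
  simp [Complex.rank_real_complex]

/-- Identity theorem on a connected open subset of the plane. -/
theorem eqOn_of_differentiableOn_of_eqOn_open {U V : Set ℂ} (hU : IsOpen U) (hc : IsPreconnected U)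
    {f g : ℂ → ℂ} (hf : DifferentiableOn ℂ f U) (hg : DifferentiableOn ℂ g U)
    (hV : IsOpen V) (hne : (U ∩ V).Nonempty) (h : EqOn f g (U ∩ V)) : EqOn f g U := by
  obtain ⟨z, hz⟩ := hne
  refine (hf.analyticOnNhd hU).eqOn_of_preconnected_of_eventuallyEq (hg.analyticOnNhd hU) hc hz.1 ?_
  filter_upwards [(hU.inter hV).mem_nhds hz] with w hw using h hw

/-! ### The exceptional values -/

/-- The exceptional values are the zeros of the entire function 1/Γ(m/2 + β), which makes openness
of the admissible set immediate. -/
theorem admissible_iff {m : ℕ} {β : ℂ} :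
    Admissible m β ↔ (Complex.Gamma ((m : ℂ) / 2 + β))⁻¹ ≠ 0 := by
  rw [ne_eq, inv_eq_zero, Complex.Gamma_eq_zero_iff, not_exists]
  refine forall_congr' fun n => not_congr ⟨fun h => ?_, fun h => ?_⟩
  · rw [h]; ring
  · linear_combination h

theorem ne_natCast_iff {β : ℂ} : (∀ n : ℕ, β ≠ n) ↔ (Complex.Gamma (-β))⁻¹ ≠ 0 := by
  rw [ne_eq, inv_eq_zero, Complex.Gamma_eq_zero_iff, not_exists]
  refine forall_congr' fun n => not_congr neg_inj.symm

theorem isOpen_setOf_admissible (m : ℕ) : IsOpen {β : ℂ | Admissible m β} := by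
  simp_rw [admissible_iff]
  exact isOpen_ne_fun (Complex.differentiable_one_div_Gamma.continuous.comp (by fun_prop))
    continuous_const

theorem isOpen_setOf_ne_natCast : IsOpen {β : ℂ | ∀ n : ℕ, β ≠ n} := by
  simp_rw [ne_natCast_iff]
  exact isOpen_ne_fun (Complex.differentiable_one_div_Gamma.continuous.comp (by fun_prop))
    continuous_const

theorem countable_setOf_not_admissible (m : ℕ) : {β : ℂ | ¬ Admissible m β}.Countable := by
  refine (countable_range fun n : ℕ => -(m : ℂ) / 2 - n).mono fun β hβ => ?_
  simp only [Admissible, mem_ofPred_eq, not_forall, not_not] at hβ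
  obtain ⟨n, hn⟩ := hβ
  exact ⟨n, hn.symm⟩

theorem countable_setOf_natCast : {β : ℂ | ¬ ∀ n : ℕ, β ≠ n}.Countable := by
  refine (countable_range fun n : ℕ => (n : ℂ)).mono fun β hβ => ?_
  simp only [mem_ofPred_eq, not_forall, not_not] at hβ
  obtain ⟨n, hn⟩ := hβ
  exact ⟨n, hn.symm⟩

theorem admissible_of_re {m : ℕ} {β : ℂ} (h : -(m : ℝ) / 2 < β.re) : Admissible m β := by
  rintro n rfl
  have : (-(m : ℂ) / 2 - n).re = -(m : ℝ) / 2 - n := by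
    have : (-(m : ℂ) / 2 - n) = ((-(m : ℝ) / 2 - n : ℝ) : ℂ) := by push_cast; rfl
    rw [this, Complex.ofReal_re]
  rw [this] at h
  linarith [(Nat.cast_nonneg n : (0 : ℝ) ≤ n)]

theorem Admissible.natCast_add {m : ℕ} {β : ℂ} (h : Admissible m β) (k : ℕ) :
    Admissible m (k + β) := by
  intro n hn
  refine h (n + k) ?_
  push_cast
  linear_combination hn

theorem isOpen_admissiblePairs (m : ℕ) : IsOpen (admissiblePairs m) := by
  have h := isOpen_setOf_admissible m
  exact (h.preimage continuous_fst).inter ((h.preimage continuous_snd).inter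
    (h.preimage (continuous_fst.add continuous_snd)))

theorem isPreconnected_setOf_admissible_add (m : ℕ) (a : ℂ) :
    IsPreconnected {β : ℂ | Admissible m β ∧ Admissible m (a + β)} := by
  have h : {β : ℂ | Admissible m β ∧ Admissible m (a + β)} =
      ({β : ℂ | ¬ Admissible m β} ∪ (fun β => a + β) ⁻¹' {β : ℂ | ¬ Admissible m β})ᶜ := by
    ext β; simp
  rw [h]
  refine (((countable_setOf_not_admissible m).union
    ((countable_setOf_not_admissible m).preimage (add_right_injective a))
    ).isConnected_compl_of_one_lt_rank ?_).isPreconnected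
  simp [Complex.rank_real_complex]

/-- Every slice with one admissible coordinate fixed is ℂ minus a countable set, hence connected.
Two points are joined by the slice α = a₁, a slice β = b and the slice α = a₂, where b avoids the
countably many values at which these slices would not meet inside the set. -/
theorem isConnected_admissiblePairs (m : ℕ) (hm : 1 ≤ m) : IsConnected (admissiblePairs m) := by
  have hm' : (0 : ℝ) < m := by exact_mod_cast hm
  refine ⟨⟨(0, 0), ?_, ?_, ?_⟩, ?_⟩
  iterate 3 exact admissible_of_re (by simp; linarith)
  refine isPreconnected_of_forall_pair ?_
  rintro ⟨a₁, b₁⟩ ⟨h1, h2, h3⟩ ⟨a₂, b₂⟩ ⟨h4, h5, h6⟩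
  dsimp only at h1 h2 h3 h4 h5 h6
  have hcount := (countable_setOf_not_admissible m).union
    (((countable_setOf_not_admissible m).preimage (add_right_injective a₁)).union
    ((countable_setOf_not_admissible m).preimage (add_right_injective a₂)))
  obtain ⟨b, hb⟩ : ((({β : ℂ | ¬ Admissible m β} ∪ ((fun β => a₁ + β) ⁻¹' {β : ℂ | ¬ Admissible m β}
      ∪ (fun β => a₂ + β) ⁻¹' {β : ℂ | ¬ Admissible m β})) : Set ℂ)ᶜ).Nonempty :=
    (hcount.isConnected_compl_of_one_lt_rank (by simp [Complex.rank_real_complex])).nonempty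
  simp only [mem_compl_iff, mem_union, mem_preimage, mem_ofPred_eq, not_or, not_not] at hb
  obtain ⟨hb1, hb2, hb3⟩ := hb
  have hv (a : ℂ) (ha : Admissible m a) :
      (fun β => (a, β)) '' {β : ℂ | Admissible m β ∧ Admissible m (a + β)} ⊆ admissiblePairs m := by
    rintro _ ⟨β, hβ, rfl⟩; exact ⟨ha, hβ⟩
  have hh : (fun α => (α, b)) '' {α : ℂ | Admissible m α ∧ Admissible m (b + α)} ⊆
      admissiblePairs m := by
    rintro _ ⟨α, hα, rfl⟩; exact ⟨hα.1, hb1, by rw [add_comm]; exact hα.2⟩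
  have pv (a : ℂ) := (isPreconnected_setOf_admissible_add m a).image (fun β => (a, β))
    (by fun_prop)
  have ph := (isPreconnected_setOf_admissible_add m b).image (fun α => (α, b)) (by fun_prop)
  refine ⟨_, union_subset (hv a₁ h1) (union_subset hh (hv a₂ h4)), Or.inl ⟨b₁, ⟨h2, h3⟩, rfl⟩,
    Or.inr (Or.inr ⟨b₂, ⟨h5, h6⟩, rfl⟩), ?_⟩
  refine (pv a₁).union (a₁, b) ⟨b, ⟨hb1, hb2⟩, rfl⟩
    (Or.inl ⟨a₁, ⟨h1, by rwa [add_comm]⟩, rfl⟩) ?_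
  exact ph.union (a₂, b) ⟨a₂, ⟨h4, by rwa [add_comm]⟩, rfl⟩ ⟨b, ⟨hb1, hb3⟩, rfl⟩ (pv a₂)

end RieszKernel

namespace RieszKernel

open MeasureTheory Set Filter Topology
open scoped SchwartzMap Laplacian Pointwise

/-! ### Polar coordinates and the antipodal map -/

theorem integral_eq_integral_polar {m : ℕ} (hm : 1 ≤ m) {g : Eu m → ℂ} (hg : Integrable g) :
    ∫ y, g y = ∫ r in Ioi (0 : ℝ), (r : ℂ) ^ (m - 1) * ∫ ω, g (r • (ω : Eu m)) ∂(surf m) := by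
  have : Nonempty (Fin m) := ⟨⟨0, hm⟩⟩
  have hmp := (volume : Measure (Eu m)).measurePreserving_homeomorphUnitSphereProd
  have hdim : Module.finrank ℝ (Eu m) = m := by simp
  rw [hdim] at hmp
  have hemb := (homeomorphUnitSphereProd (Eu m)).measurableEmbedding
  set G : Metric.sphere (0 : Eu m) 1 × Ioi (0 : ℝ) → ℂ :=
    fun p => g ((p.2 : ℝ) • (p.1 : Eu m)) with hG
  have hcomp (x : ({0}ᶜ : Set (Eu m))) : G (homeomorphUnitSphereProd (Eu m) x) = g x := by
    have hx : ‖(x : Eu m)‖ ≠ 0 := norm_ne_zero_iff.2 x.2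
    simp [G, smul_smul, hx]
  have h1 : ∫ y, g y = ∫ x : ({0}ᶜ : Set (Eu m)), g x ∂(volume.comap Subtype.val) := by
    rw [integral_subtype_comap (measurableSet_singleton _).compl g, restrict_compl_singleton]
  have hGint : Integrable G ((surf m).prod (Measure.volumeIoiPow (m - 1))) := by
    rw [← hmp.integrable_comp_emb hemb]
    have h2 : Integrable g (volume.restrict ({0}ᶜ : Set (Eu m))) := hg.restrict
    rw [← IntegrableOn, integrableOn_iff_comap_subtypeVal (by measurability)] at h2
    refine h2.congr (.of_forall fun x => ?_)
    exact (hcomp x).symm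
  rw [h1]
  have h3 : ∫ x : ({0}ᶜ : Set (Eu m)), g x ∂(volume.comap Subtype.val) =
      ∫ p, G p ∂((surf m).prod (Measure.volumeIoiPow (m - 1))) := by
    rw [← hmp.integral_comp hemb G]
    exact integral_congr_ae (.of_forall fun x => (hcomp x).symm)
  rw [h3, integral_prod_symm _ hGint]
  simp only [Measure.volumeIoiPow, ENNReal.ofReal]
  rw [integral_withDensity_eq_integral_smul]
  · have := integral_subtype_comap (μ := (volume : Measure ℝ)) measurableSet_Ioi
      (fun a : ℝ => Real.toNNReal (a ^ (m - 1)) • ∫ ω, g (a • (ω : Eu m)) ∂(surf m)) (s := Ioi 0)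
    rw [this]
    refine setIntegral_congr_fun measurableSet_Ioi fun x hx => ?_
    simp only [NNReal.smul_def]
    rw [Real.coe_toNNReal _ (pow_nonneg (le_of_lt hx) _), Complex.real_smul, Complex.ofReal_pow]
  · exact (measurable_subtype_coe.pow_const _).real_toNNReal

theorem sphereArea_pos {m : ℕ} (hm : 1 ≤ m) : 0 < sphereArea m := by
  have : Nonempty (Fin m) := ⟨⟨0, hm⟩⟩
  have : Nontrivial (Eu m) := inferInstance
  rw [sphereArea, Measure.real, ENNReal.toReal_pos_iff]
  refine ⟨?_, measure_lt_top _ _⟩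
  rw [pos_iff_ne_zero, ne_eq, Measure.measure_univ_eq_zero]
  exact Measure.toSphere_ne_zero _

/-- The surface measure of a set is a multiple of the volume of the cone over it, and volume is
invariant under x ↦ -x. -/
theorem measurePreserving_neg_surf (m : ℕ) :
    MeasurePreserving (fun ω : Metric.sphere (0 : Eu m) 1 => -ω) (surf m) (surf m) := by
  have hc : Continuous (fun ω : Metric.sphere (0 : Eu m) 1 => -ω) := continuous_neg
  refine ⟨hc.measurable, ?_⟩
  ext s hs
  rw [Measure.map_apply hc.measurable hs, Measure.toSphere_apply' _ (hc.measurable hs),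
    Measure.toSphere_apply' _ hs]
  congr 1
  have h : Ioo (0 : ℝ) 1 • ((↑) '' ((fun ω : Metric.sphere (0 : Eu m) 1 => -ω) ⁻¹' s) : Set (Eu m)) =
      -(Ioo (0 : ℝ) 1 • ((↑) '' s : Set (Eu m))) := by
    ext y
    simp only [Set.mem_smul, Set.mem_neg, mem_image, mem_preimage]
    constructor
    · rintro ⟨r, hr, _, ⟨ω, hω, rfl⟩, rfl⟩
      exact ⟨r, hr, _, ⟨-ω, hω, rfl⟩, by simp⟩
    · rintro ⟨r, hr, _, ⟨ω, hω, rfl⟩, h⟩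
      exact ⟨r, hr, _, ⟨-ω, by simpa using hω, rfl⟩, by
        rw [← neg_neg y, ← h]; simp⟩
  rw [h, Measure.measure_neg]

/-- The antipodal map changes the sign of an odd derivative along a ray at 0. This is why the finite
part, as a function of β, has possible poles only at β ∈ ℕ and not at the half-integers. -/
theorem rayDeriv_zero_of_odd {m k : ℕ} (hk : Odd k) (φ : 𝓢(Eu m, ℂ)) : rayDeriv k φ 0 = 0 := by
  have h := (measurePreserving_neg_surf m).integral_comp
    (Homeomorph.neg (Metric.sphere (0 : Eu m) 1)).measurableEmbedding
    (fun ω => iteratedDeriv k (fun t : ℝ => φ (t • (ω : Eu m))) 0)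
  have h2 (ω : Metric.sphere (0 : Eu m) 1) :
      iteratedDeriv k (fun t : ℝ => φ (t • ((-ω : Metric.sphere (0 : Eu m) 1) : Eu m))) 0 =
      - iteratedDeriv k (fun t : ℝ => φ (t • (ω : Eu m))) 0 := by
    have := iteratedDeriv_comp_neg k (fun t : ℝ => φ (t • (ω : Eu m))) 0
    simp only [neg_zero, hk.neg_one_pow, neg_smul, one_smul] at this
    rw [← this]
    simp
  simp only [h2, integral_neg] at h
  rw [rayDeriv]
  exact self_eq_neg.1 h.symm

end RieszKernel

namespace RieszKernel

open MeasureTheory Set Filter Topology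
open scoped SchwartzMap Laplacian

/-! ### The finite part with a varying number of Taylor terms -/

theorem integrableOn_cpow_mul_rayRem {m : ℕ} (β : ℂ) (N : ℕ) (hN : 2 * β.re < N)
    (φ : 𝓢(Eu m, ℂ)) :
    IntegrableOn (fun r : ℝ => (r : ℂ) ^ (-2 * β - 1) * rayRem N 0 φ r) (Ioc 0 1) := by
  have h1 : IntegrableOn (fun r : ℝ => r ^ (N - 2 * β.re - 1)) (Ioc 0 1) := by
    have := intervalIntegral.intervalIntegrable_rpow' (a := 0) (b := 1)
      (r := N - 2 * β.re - 1) (by linarith)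
    rwa [intervalIntegrable_iff_integrableOn_Ioc_of_le zero_le_one] at this
  refine Integrable.mono' (h1.const_mul (SchwartzMap.seminorm ℂ 0 N φ * (surf m).real univ)) ?_ ?_
  · exact (((continuousOn_cpow_pos _).mono Ioc_subset_Ioi_self).mul
      (continuous_rayRem _ _ φ).continuousOn).aestronglyMeasurable measurableSet_Ioc
  · refine (ae_restrict_iff' measurableSet_Ioc).2 (.of_forall fun r hr => ?_)
    have h := norm_rayRem_le φ N 0 r hr.1.le
    rw [zero_add] at h
    rw [norm_mul, Complex.norm_cpow_eq_rpow_re_of_pos hr.1]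
    have e : r ^ (N - 2 * β.re - 1) = r ^ (-2 * β - 1).re * r ^ N := by
      rw [← Real.rpow_natCast r N, ← Real.rpow_add hr.1]
      congr 1
      simp
      ring
    rw [e]
    calc r ^ (-2 * β - 1).re * ‖rayRem N 0 φ r‖
        ≤ r ^ (-2 * β - 1).re * (SchwartzMap.seminorm ℂ 0 N φ * (surf m).real univ * r ^ N) := by
          gcongr
          exact Real.rpow_nonneg hr.1.le _
      _ = _ := by ring

/-- The contribution of `(0, 1]` to the finite part of `∫ r^(-2β-1) rayDeriv 0 φ r dr`, with `N`
Taylor terms subtracted. -/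
noncomputable def nearPart {m : ℕ} (N : ℕ) (β : ℂ) (φ : 𝓢(Eu m, ℂ)) : ℂ :=
  (∫ r in Ioc (0 : ℝ) 1, (r : ℂ) ^ (-2 * β - 1) * rayRem N 0 φ r)
    + ∑ k ∈ Finset.range N, rayDeriv k φ 0 / (Nat.factorial k : ℂ) / (k - 2 * β)

/-- The contribution of `(1, ∞)` to the finite part. -/
noncomputable def farPart {m : ℕ} (β : ℂ) (φ : 𝓢(Eu m, ℂ)) : ℂ :=
  ∫ r in Ioi (1 : ℝ), (r : ℂ) ^ (-2 * β - 1) * rayDeriv 0 φ r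

/-- The extra Taylor term removed under the integral contributes ∫₀¹ r^(N-2β-1) dr = 1/(N-2β), which
is exactly the summand added outside. -/
theorem nearPart_succ {m : ℕ} (N : ℕ) (β : ℂ) (hN : 2 * β.re < N) (φ : 𝓢(Eu m, ℂ)) :
    nearPart (N + 1) β φ = nearPart N β φ := by
  have hre : (N - 2 * β - 1 : ℂ).re = N - 2 * β.re - 1 := by simp
  have hne : (N : ℂ) - 2 * β ≠ 0 := fun h => by
    have := congrArg Complex.re h
    simp at this
    linarith
  have h1 : ∫ r in Ioc (0 : ℝ) 1, (r : ℂ) ^ (N - 2 * β - 1 : ℂ) = 1 / (N - 2 * β) := by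
    rw [← intervalIntegral.integral_of_le zero_le_one, integral_cpow]
    · have hz : (N - 2 * β - 1 + 1 : ℂ) ≠ 0 := by simpa using hne
      simp only [Complex.ofReal_one, Complex.one_cpow, Complex.ofReal_zero, Complex.zero_cpow hz]
      simp
    · left; rw [hre]; linarith
  have h2 (r : ℝ) (hr : r ∈ Ioc (0 : ℝ) 1) :
      (r : ℂ) ^ (-2 * β - 1) * rayRem (N + 1) 0 φ r =
      (r : ℂ) ^ (-2 * β - 1) * rayRem N 0 φ r
        - rayDeriv N φ 0 / (Nat.factorial N : ℂ) * (r : ℂ) ^ (N - 2 * β - 1 : ℂ) := by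
    have hr0 : (r : ℂ) ≠ 0 := Complex.ofReal_ne_zero.2 hr.1.ne'
    have e : (r : ℂ) ^ (N - 2 * β - 1 : ℂ) = (r : ℂ) ^ (-2 * β - 1) * (r : ℂ) ^ N := by
      rw [← Complex.cpow_natCast, ← Complex.cpow_add _ _ hr0]
      congr 1; ring
    rw [e, rayRem, rayRem, Finset.sum_range_succ, zero_add]
    ring
  have h3 : IntegrableOn (fun r : ℝ => (r : ℂ) ^ (N - 2 * β - 1 : ℂ)) (Ioc 0 1) := by
    have := intervalIntegral.intervalIntegrable_cpow' (a := 0) (b := 1)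
      (r := N - 2 * β - 1) (by rw [hre]; linarith)
    rwa [intervalIntegrable_iff_integrableOn_Ioc_of_le zero_le_one] at this
  rw [nearPart, nearPart, setIntegral_congr_fun measurableSet_Ioc h2,
    integral_sub (integrableOn_cpow_mul_rayRem β N hN φ) (h3.const_mul _), integral_const_mul, h1,
    Finset.sum_range_succ]
  ring

theorem nearPart_eq_of_lt {m : ℕ} {N N' : ℕ} {β : ℂ} (hN : 2 * β.re < N) (hN' : 2 * β.re < N')
    (φ : 𝓢(Eu m, ℂ)) : nearPart N β φ = nearPart N' β φ := by
  wlog h : N ≤ N' generalizing N N'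
  · exact (this hN' hN (le_of_not_ge h)).symm
  induction N', h using Nat.le_induction with
  | base => rfl
  | succ n hn ih =>
    have : 2 * β.re < n := hN.trans_le (by exact_mod_cast hn)
    rw [nearPart_succ n β this, ih this]

/-- The number of Taylor terms in the definition jumps with Re β. Keeping a fixed large `N` is what
makes holomorphic dependence on β visible. -/
theorem radialPairing_eq_near_add_far {m : ℕ} (hm : 1 ≤ m) {N : ℕ} {β : ℂ} (hN : 2 * β.re < N)
    (φ : 𝓢(Eu m, ℂ)) :
    radialPairing (-(m : ℂ) - 2 * β) φ = nearPart N β φ + farPart β φ := by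
  have hs : ((sphereArea m : ℝ) : ℂ) ≠ 0 := Complex.ofReal_ne_zero.2 (sphereArea_pos hm).ne'
  have e : -(m : ℂ) - 2 * β + m - 1 = -2 * β - 1 := by ring
  have hN0 : 2 * β.re < (⌈-(-2 * β - 1).re⌉₊ : ℕ) := by
    refine lt_of_lt_of_le ?_ (Nat.le_ceil _)
    simp
  rw [nearPart_eq_of_lt hN hN0, radialPairing_eq, e, mul_inv_cancel₀ hs, one_smul]
  have hn : nearCLM m (-2 * β - 1) φ =
    ∫ r in Ioc (0 : ℝ) 1, (r : ℂ) ^ (-2 * β - 1) * rayRem ⌈-(-2 * β - 1).re⌉₊ 0 φ r := rfl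
  have hf : farCLM m (-2 * β - 1) φ = farPart β φ := rfl
  have hr (k : ℕ) : rayCLM m k φ = rayDeriv k φ 0 := rfl
  simp only [smul_apply, add_apply, sum_apply, hn, hf, hr, smul_eq_mul, nearPart]
  congr 2
  refine Finset.sum_congr rfl fun k _ => ?_
  rw [show -2 * β - 1 + (k : ℂ) + 1 = k - 2 * β by ring]
  simp only [div_eq_mul_inv]
  ring

theorem norm_cpow_le_of_le_one {r : ℝ} (hr : r ∈ Ioc (0 : ℝ) 1) {z : ℂ} {a : ℝ} (h : a ≤ z.re) :
    ‖(r : ℂ) ^ z‖ ≤ r ^ a := by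
  rw [Complex.norm_cpow_eq_rpow_re_of_pos hr.1]
  exact Real.rpow_le_rpow_of_exponent_ge hr.1 hr.2 h

theorem differentiable_cpow_affine {c : ℂ} (hc : c ≠ 0) (a b : ℂ) :
    Differentiable ℂ (fun β : ℂ => c ^ (a * β + b)) := by
  intro β
  exact DifferentiableAt.const_cpow (by fun_prop) (Or.inl hc)

/-- The margin 1 in 2 Re β + 1 < N gives |r^(-2β-1)| ≤ r^(-N), which the O(r^N) remainder cancels,
so a constant dominates the integrand. The summands have poles at β = k/2, but those with odd k
vanish identically. -/
theorem differentiableOn_nearPart {m : ℕ} (N : ℕ) (φ : 𝓢(Eu m, ℂ)) :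
    DifferentiableOn ℂ (fun β => nearPart N β φ)
      ({β : ℂ | 2 * β.re + 1 < N} ∩ {β : ℂ | ∀ n : ℕ, β ≠ n}) := by
  have hopen : IsOpen {β : ℂ | 2 * β.re + 1 < N} := isOpen_lt (by fun_prop) (by fun_prop)
  refine DifferentiableOn.add ?_ (DifferentiableOn.fun_sum fun k _ => ?_)
  · refine DifferentiableOn.mono ?_ inter_subset_left
    refine differentiableOn_integral_of_locally_dominated hopen ?_ ?_ ?_
    · intro β hβ
      exact (integrableOn_cpow_mul_rayRem β N (by have : 2 * β.re + 1 < N := hβ; linarith)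
        φ).aestronglyMeasurable
    · refine (ae_restrict_iff' measurableSet_Ioc).2 (.of_forall fun r hr => ?_)
      have := differentiable_cpow_affine (Complex.ofReal_ne_zero.2 hr.1.ne') (-2) (-1)
      exact (this.mul_const _).differentiableOn
    · intro β₀ hβ₀
      obtain ⟨ε, hε, hball⟩ := Metric.isOpen_iff.1 hopen β₀ hβ₀
      refine ⟨ε, hε, fun _ => SchwartzMap.seminorm ℂ 0 N φ * (surf m).real univ,
        integrableOn_const (by simp), ?_⟩
      refine (ae_restrict_iff' measurableSet_Ioc).2 (.of_forall fun r hr β hβ => ?_)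
      have h := norm_rayRem_le φ N 0 r hr.1.le
      rw [zero_add] at h
      have hβ' : 2 * β.re + 1 < N := hball hβ
      have hp : ‖(r : ℂ) ^ (-2 * β - 1)‖ ≤ r ^ (-(N : ℝ)) :=
        norm_cpow_le_of_le_one hr (by simp; linarith)
      rw [norm_mul]
      have hrN : r ^ (-(N : ℝ)) * r ^ N = 1 := by
        rw [← Real.rpow_natCast r N, ← Real.rpow_add hr.1]; simp
      have hnn : 0 ≤ r ^ (-(N : ℝ)) := Real.rpow_nonneg hr.1.le _
      calc _ ≤ r ^ (-(N : ℝ)) * (SchwartzMap.seminorm ℂ 0 N φ * (surf m).real univ * r ^ N) := by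
            gcongr
        _ = SchwartzMap.seminorm ℂ 0 N φ * (surf m).real univ * (r ^ (-(N : ℝ)) * r ^ N) := by ring
        _ = _ := by rw [hrN, mul_one]
  · rcases Nat.even_or_odd' k with ⟨l, rfl | rfl⟩
    · refine DifferentiableOn.div (by fun_prop) (by fun_prop) fun β hβ h => ?_
      refine hβ.2 l ?_
      push_cast at h
      linear_combination (-1 / 2 : ℂ) * h
    · simp [rayDeriv_zero_of_odd (odd_two_mul_add_one l)]

theorem differentiable_farPart {m : ℕ} (φ : 𝓢(Eu m, ℂ)) :
    Differentiable ℂ (fun β => farPart β φ) := by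
  rw [← differentiableOn_univ]
  refine differentiableOn_integral_of_locally_dominated isOpen_univ ?_ ?_ ?_
  · intro β _
    exact (integrableOn_far (-2 * β - 1) φ).aestronglyMeasurable
  · refine (ae_restrict_iff' measurableSet_Ioi).2 (.of_forall fun r hr => ?_)
    have hr0 : (r : ℂ) ≠ 0 := Complex.ofReal_ne_zero.2 (lt_trans one_pos hr).ne'
    exact ((differentiable_cpow_affine hr0 (-2) (-1)).mul_const _).differentiableOn
  · intro β₀ _
    -- For |β - β₀| < 1 the real part of -2β - 1 stays below that of -2β₀ + 1, and r > 1.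
    refine ⟨1, one_pos, _, (integrableOn_far (-2 * β₀ + 1) φ).norm, ?_⟩
    refine (ae_restrict_iff' measurableSet_Ioi).2 (.of_forall fun r hr β hβ => ?_)
    have hr1 : 1 < r := hr
    have hr0 : 0 < r := one_pos.trans hr1
    have hb : |(β - β₀).re| < 1 := (Complex.abs_re_le_norm _).trans_lt (by
      rwa [Metric.mem_ball, dist_eq_norm] at hβ)
    rw [norm_mul, norm_mul]
    gcongr ?_ * _
    rw [Complex.norm_cpow_eq_rpow_re_of_pos hr0, Complex.norm_cpow_eq_rpow_re_of_pos hr0]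
    refine Real.rpow_le_rpow_of_exponent_le hr1.le ?_
    rw [Complex.sub_re] at hb
    simp
    linarith [(abs_lt.1 hb).1]

theorem differentiableOn_radialPairing {m : ℕ} (hm : 1 ≤ m) (φ : 𝓢(Eu m, ℂ)) :
    DifferentiableOn ℂ (fun β => radialPairing (-(m : ℂ) - 2 * β) φ) {β : ℂ | ∀ n : ℕ, β ≠ n} := by
  intro β₀ hβ₀
  obtain ⟨N, hN⟩ := exists_nat_gt (2 * β₀.re + 1)
  have hopen : IsOpen ({β : ℂ | 2 * β.re + 1 < N} ∩ {β : ℂ | ∀ n : ℕ, β ≠ n}) :=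
    (isOpen_lt (by fun_prop) (by fun_prop)).inter isOpen_setOf_ne_natCast
  have h := ((differentiableOn_nearPart N φ).differentiableAt (hopen.mem_nhds ⟨hN, hβ₀⟩)).add
    (differentiable_farPart φ β₀)
  refine (h.congr_of_eventuallyEq ?_).differentiableWithinAt
  filter_upwards [hopen.mem_nhds ⟨hN, hβ₀⟩] with β hβ
  have : 2 * β.re + 1 < N := hβ.1
  exact radialPairing_eq_near_add_far hm (by linarith) φ

/-! ### The finite part as an integral over the space -/

theorem integrable_norm_rpow_mul {m : ℕ} (hm : 1 ≤ m) {s : ℝ} (hs : -(m : ℝ) < s)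
    (φ : 𝓢(Eu m, ℂ)) : Integrable (fun y : Eu m => ‖y‖ ^ s * ‖φ y‖) := by
  have : Nonempty (Fin m) := ⟨⟨0, hm⟩⟩
  have h1 : IntegrableOn (fun y : Eu m => ‖y‖ ^ s) (Metric.ball 0 1) := by
    rw [integrableOn_fun_norm_addHaar volume (f := fun r : ℝ => r ^ s)]
    have h := intervalIntegral.intervalIntegrable_rpow' (a := 0) (b := 1)
      (r := m - 1 + s) (by linarith)
    rw [intervalIntegrable_iff_integrableOn_Ioo_of_le zero_le_one] at h
    refine h.congr_fun (fun r hr => ?_) measurableSet_Ioo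
    simp only [finrank_euclideanSpace, Fintype.card_fin, smul_eq_mul]
    rw [← Real.rpow_natCast, ← Real.rpow_add hr.1, Nat.cast_sub hm, Nat.cast_one]
  have h2 : Integrable ((Metric.ball (0 : Eu m) 1).indicator (fun y : Eu m => ‖y‖ ^ s)) :=
    h1.integrable_indicator measurableSet_ball
  refine Integrable.mono' ((h2.mul_const (SchwartzMap.seminorm ℂ 0 0 φ)).add
    (SchwartzMap.integrable_pow_mul volume φ ⌈s⌉₊)) ?_ (.of_forall fun y => ?_)
  · exact ((measurable_norm.pow_const s).mul φ.continuous.norm.measurable).aestronglyMeasurable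
  · have hy : 0 ≤ ‖y‖ ^ s := Real.rpow_nonneg (norm_nonneg _) _
    rw [Real.norm_of_nonneg (by positivity), Pi.add_apply]
    by_cases h : y ∈ Metric.ball (0 : Eu m) 1
    · rw [indicator_of_mem h]
      have := SchwartzMap.norm_le_seminorm ℂ φ y
      have h3 : 0 ≤ ‖y‖ ^ ⌈s⌉₊ * ‖φ y‖ := by positivity
      nlinarith [mul_le_mul_of_nonneg_left this hy]
    · rw [indicator_of_notMem h, zero_mul, zero_add]
      have h1 : 1 ≤ ‖y‖ := by simpa using h
      gcongr
      rw [← Real.rpow_natCast]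
      exact Real.rpow_le_rpow_of_exponent_le h1 (Nat.le_ceil s)

theorem integrableOn_norm_rpow_mul {m : ℕ} (s : ℝ) (φ : 𝓢(Eu m, ℂ)) :
    IntegrableOn (fun y : Eu m => ‖y‖ ^ s * ‖φ y‖) {y | 1 < ‖y‖} := by
  refine Integrable.mono' (SchwartzMap.integrable_pow_mul volume φ ⌈s⌉₊).integrableOn ?_ ?_
  · exact ((measurable_norm.pow_const s).mul φ.continuous.norm.measurable).aestronglyMeasurable
  · refine (ae_restrict_iff' (measurableSet_lt measurable_const measurable_norm)).2
      (.of_forall fun y hy => ?_)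
    have h1 : 1 < ‖y‖ := hy
    have hy : 0 ≤ ‖y‖ ^ s := Real.rpow_nonneg (norm_nonneg _) _
    rw [Real.norm_of_nonneg (by positivity)]
    gcongr
    rw [← Real.rpow_natCast]
    exact Real.rpow_le_rpow_of_exponent_le h1.le (Nat.le_ceil s)

theorem measurable_norm_cpow {m : ℕ} (z : ℂ) : Measurable (fun y : Eu m => (‖y‖ : ℂ) ^ z) :=
  (Complex.measurable_ofReal.comp measurable_norm).pow_const z

theorem ae_ne_zero {m : ℕ} (hm : 1 ≤ m) : ∀ᵐ y : Eu m, y ≠ 0 := by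
  have : Nonempty (Fin m) := ⟨⟨0, hm⟩⟩
  have : Nontrivial (Eu m) := inferInstance
  exact compl_mem_ae_iff.2 (measure_singleton 0)

theorem integrable_norm_cpow_mul {m : ℕ} (hm : 1 ≤ m) {z : ℂ} (hz : -(m : ℝ) < z.re)
    (φ : 𝓢(Eu m, ℂ)) : Integrable (fun y : Eu m => (‖y‖ : ℂ) ^ z * φ y) := by
  refine (integrable_norm_rpow_mul hm hz φ).mono
    ((measurable_norm_cpow z).mul φ.continuous.measurable).aestronglyMeasurable ?_
  filter_upwards [ae_ne_zero hm] with y hy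
  rw [norm_mul, Complex.norm_cpow_eq_rpow_re_of_pos (norm_pos_iff.2 hy), norm_mul, norm_norm,
    Real.norm_of_nonneg (Real.rpow_nonneg (norm_nonneg _) _)]

theorem pow_mul_cpow_eq {m : ℕ} (hm : 1 ≤ m) {r : ℝ} (hr : 0 < r) (β : ℂ) :
    (r : ℂ) ^ (m - 1) * (r : ℂ) ^ (-(m : ℂ) - 2 * β) = (r : ℂ) ^ (-2 * β - 1) := by
  rw [← Complex.cpow_natCast, ← Complex.cpow_add _ _ (Complex.ofReal_ne_zero.2 hr.ne'),
    Nat.cast_sub hm]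
  congr 1
  push_cast
  ring

theorem integral_sphere_cpow_norm_mul {m : ℕ} (z : ℂ) (φ : 𝓢(Eu m, ℂ)) {r : ℝ} (hr : 0 < r) :
    ∫ ω : Metric.sphere (0 : Eu m) 1, (‖r • (ω : Eu m)‖ : ℂ) ^ z * φ (r • (ω : Eu m)) ∂(surf m) =
      (r : ℂ) ^ z * rayDeriv 0 φ r := by
  rw [rayDeriv, ← integral_const_mul]
  simp only [norm_smul, norm_eq_of_mem_sphere, mul_one, Real.norm_of_nonneg hr.le, iteratedDeriv_zero]

theorem farPart_eq_integral {m : ℕ} (hm : 1 ≤ m) (β : ℂ) (φ : 𝓢(Eu m, ℂ)) :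
    farPart β φ = ∫ y in {y : Eu m | 1 < ‖y‖}, (‖y‖ : ℂ) ^ (-(m : ℂ) - 2 * β) * φ y := by
  have hms : MeasurableSet {y : Eu m | 1 < ‖y‖} := measurableSet_lt measurable_const measurable_norm
  have hint : IntegrableOn (fun y : Eu m => (‖y‖ : ℂ) ^ (-(m : ℂ) - 2 * β) * φ y)
      {y : Eu m | 1 < ‖y‖} := by
    refine Integrable.mono (integrableOn_norm_rpow_mul (-(m : ℂ) - 2 * β).re φ)
      ((measurable_norm_cpow _).mul φ.continuous.measurable).aestronglyMeasurable ?_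
    refine (ae_restrict_iff' hms).2 (.of_forall fun y hy => ?_)
    rw [norm_mul, Complex.norm_cpow_eq_rpow_re_of_pos (one_pos.trans hy), norm_mul, norm_norm,
      Real.norm_of_nonneg (Real.rpow_nonneg (norm_nonneg _) _)]
  rw [← integral_indicator hms, integral_eq_integral_polar hm (hint.integrable_indicator hms),
    farPart, ← integral_indicator measurableSet_Ioi, ← integral_indicator measurableSet_Ioi]
  congr 1
  ext r
  by_cases h0 : r ∈ Ioi (0 : ℝ)
  · have hr0 : 0 < r := h0
    rw [indicator_of_mem h0]
    by_cases h1 : r ∈ Ioi (1 : ℝ)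
    · rw [indicator_of_mem h1]
      have h2 (ω : Metric.sphere (0 : Eu m) 1) : r • (ω : Eu m) ∈ {y : Eu m | 1 < ‖y‖} := by
        simpa [norm_smul, abs_of_pos hr0] using h1
      simp only [indicator_of_mem (h2 _)]
      rw [integral_sphere_cpow_norm_mul _ _ hr0, ← mul_assoc, pow_mul_cpow_eq hm hr0]
    · rw [indicator_of_notMem h1]
      have h2 (ω : Metric.sphere (0 : Eu m) 1) : r • (ω : Eu m) ∉ {y : Eu m | 1 < ‖y‖} := by
        simpa [norm_smul, abs_of_pos hr0] using h1
      simp only [indicator_of_notMem (h2 _)]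
      simp
  · have h1 : r ∉ Ioi (1 : ℝ) := fun h1 => h0 (zero_lt_one.trans (mem_Ioi.1 h1))
    rw [indicator_of_notMem h0, indicator_of_notMem h1]

/-- For Re β < 0 no Taylor term has to be subtracted: `N = 0` is allowed, and the finite part is the
absolutely convergent integral in polar coordinates. -/
theorem radialPairing_eq_integral {m : ℕ} (hm : 1 ≤ m) {β : ℂ} (hβ : β.re < 0) (φ : 𝓢(Eu m, ℂ)) :
    radialPairing (-(m : ℂ) - 2 * β) φ = ∫ y : Eu m, (‖y‖ : ℂ) ^ (-(m : ℂ) - 2 * β) * φ y := by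
  have hβ' : 2 * β.re < (0 : ℕ) := by push_cast; linarith
  have hre : (-(m : ℂ) - 2 * β).re = -m - 2 * β.re := by simp
  have hr0 (r : ℝ) : rayRem 0 0 φ r = rayDeriv 0 φ r := by simp [rayRem]
  have hn := integrableOn_cpow_mul_rayRem β 0 hβ' φ
  simp only [hr0] at hn
  rw [radialPairing_eq_near_add_far hm hβ', nearPart, Finset.sum_range_zero, add_zero,
    integral_eq_integral_polar hm (integrable_norm_cpow_mul hm (by rw [hre]; linarith) φ), farPart]
  simp only [hr0]
  rw [← setIntegral_union (by
      rw [Set.disjoint_left]; intro r hr hr'; exact absurd hr.2 (not_le.2 hr')) measurableSet_Ioi hn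
      (integrableOn_far _ φ), Ioc_union_Ioi_eq_Ioi zero_le_one]
  refine setIntegral_congr_fun measurableSet_Ioi fun r hr => ?_
  rw [integral_sphere_cpow_norm_mul _ _ hr, ← mul_assoc, pow_mul_cpow_eq hm hr]

end RieszKernel

namespace RieszKernel

open MeasureTheory Set Filter Topology
open scoped SchwartzMap Laplacian FourierTransform

/-! ### Explicit formulas for the kernels -/

/-- The constant `c_β` with `(-Δ)^β δ = c_β Fp r^(-m-2β)` for `β ≠ 0, 1, 2, …`. -/
noncomputable def rieszConst (m : ℕ) (β : ℂ) : ℂ :=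
  (2 : ℂ) ^ (2 * β) * Complex.Gamma ((m : ℂ) / 2 + β) *
    ((Real.pi : ℂ) ^ (-((m : ℂ) / 2)) * (Complex.Gamma (-β))⁻¹)

theorem kernel_apply {m : ℕ} {β : ℂ} (hβ : ∀ n : ℕ, β ≠ n) (φ : 𝓢(Eu m, ℂ)) :
    kernel m β φ = rieszConst m β * radialPairing (-(m : ℂ) - 2 * β) φ := by
  have hne : ¬ ∃ l : ℕ, -(m : ℂ) - 2 * β = -(m : ℂ) - 2 * l := by
    rintro ⟨l, hl⟩
    exact hβ l (by linear_combination (-1 / 2 : ℂ) * hl)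
  have hpi : (Real.pi : ℂ) ≠ 0 := Complex.ofReal_ne_zero.2 Real.pi_ne_zero
  rw [kernel, Tstar, dif_neg hne, smul_smul]
  change _ * T m _ φ = _
  rw [T_apply, rieszConst]
  congr 1
  rw [show (-(m : ℂ) - 2 * β + m) / 2 = -β by ring, show ((m : ℂ) + 2 * β) / 2 = m / 2 + β by ring]
  have e : (Real.pi : ℂ) ^ (-β) =
      (Real.pi : ℂ) ^ (-((m : ℂ) / 2)) * (Real.pi : ℂ) ^ (((m : ℂ) - 2 * β) / 2) := by
    rw [← Complex.cpow_add _ _ hpi]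
    congr 1; ring
  rw [e]
  have h0 : (Real.pi : ℂ) ^ (((m : ℂ) - 2 * β) / 2) ≠ 0 := by simp [Complex.cpow_eq_zero_iff, hpi]
  field_simp

theorem kernel_natCast {m : ℕ} (hm : 1 ≤ m) (l : ℕ) : kernel m l = negLaplacianPowDelta m l := by
  have h : ∃ k : ℕ, -(m : ℂ) - 2 * (l : ℂ) = -(m : ℂ) - 2 * k := ⟨l, rfl⟩
  have hpi : (Real.pi : ℂ) ≠ 0 := Complex.ofReal_ne_zero.2 Real.pi_ne_zero
  -- The natural number chosen in the definition of `Tstar` is determined by the exponent.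
  have hch : h.choose = l := by
    have := h.choose_spec
    have h2 : (l : ℂ) = h.choose := by linear_combination (-1 / 2 : ℂ) * this
    exact_mod_cast h2.symm
  rw [kernel, Tstar, dif_pos h, hch, smul_smul]
  convert one_smul ℂ _
  rw [show ((m : ℂ) + 2 * l) / 2 = m / 2 + l by ring,
    show ((m : ℂ) - 2 * l) / 2 = m / 2 - l by ring]
  have h0 : (Real.pi : ℂ) ^ ((m : ℂ) / 2 - l) ≠ 0 := by simp [Complex.cpow_eq_zero_iff, hpi]
  have h1 : Complex.Gamma ((m : ℂ) / 2 + l) ≠ 0 := by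
    refine Complex.Gamma_ne_zero_of_re_pos ?_
    have : (0 : ℝ) < m := by exact_mod_cast hm
    have e : (m : ℂ) / 2 + l = ((m / 2 + l : ℝ) : ℂ) := by push_cast; rfl
    rw [e, Complex.ofReal_re]
    positivity
  have h2 : (2 : ℂ) ^ (2 * (l : ℂ)) = 2 ^ (2 * l) := by
    rw [← Complex.cpow_natCast]; push_cast; rfl
  rw [h2]
  generalize Complex.Gamma ((m : ℂ) / 2 + l) = G at h1 ⊢
  field_simp

theorem rieszConst_ne_zero {m : ℕ} {β : ℂ} (hβ : ∀ n : ℕ, β ≠ n) (ha : Admissible m β) :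
    rieszConst m β ≠ 0 := by
  have hpi : (Real.pi : ℂ) ≠ 0 := Complex.ofReal_ne_zero.2 Real.pi_ne_zero
  have h1 := inv_ne_zero (admissible_iff.1 ha)
  rw [inv_inv] at h1
  simp only [rieszConst, ne_eq, mul_eq_zero, not_or]
  exact ⟨⟨by simp [Complex.cpow_eq_zero_iff], h1⟩, by simp [Complex.cpow_eq_zero_iff, hpi],
    ne_natCast_iff.1 hβ⟩

/-- 1/Γ(-β) is entire, so only the poles of Γ(m/2 + β), which are the exceptional values, have to be
avoided. -/
theorem differentiableOn_rieszConst (m : ℕ) :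
    DifferentiableOn ℂ (rieszConst m) {β | Admissible m β} := by
  have h1 : DifferentiableOn ℂ (fun β : ℂ => Complex.Gamma ((m : ℂ) / 2 + β))
      {β | Admissible m β} := fun β hβ =>
    ((Complex.differentiableAt_Gamma _ fun n hn => hβ n (by linear_combination hn)).comp β
      (f := fun β : ℂ => (m : ℂ) / 2 + β) (by fun_prop)).differentiableWithinAt
  have h2 : Differentiable ℂ (fun β : ℂ => (Complex.Gamma (-β))⁻¹) :=
    Complex.differentiable_one_div_Gamma.comp (f := fun β : ℂ => -β) (by fun_prop)
  have h3 : Differentiable ℂ (fun β : ℂ => (2 : ℂ) ^ (2 * β)) := by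
    simpa using differentiable_cpow_affine (two_ne_zero) 2 0
  exact (h3.differentiableOn.mul h1).mul (h2.const_mul _).differentiableOn

theorem differentiableOn_kernel_of_ne {m : ℕ} (hm : 1 ≤ m) (φ : 𝓢(Eu m, ℂ)) :
    DifferentiableOn ℂ (fun β => kernel m β φ)
      ({β : ℂ | Admissible m β} ∩ {β : ℂ | ∀ n : ℕ, β ≠ n}) :=
  (((differentiableOn_rieszConst m).mono inter_subset_left).mul
    ((differentiableOn_radialPairing hm φ).mono inter_subset_right)).congr
    fun _ hβ => kernel_apply hβ.2 φ

/-! ### The Fourier side -/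

/-- The symbol `(2π|ξ|)^(2β)` of `(-Δ)^β`. -/
noncomputable def symbol {m : ℕ} (β : ℂ) (ξ : Eu m) : ℂ :=
  ((2 * Real.pi * ‖ξ‖ : ℝ) : ℂ) ^ (2 * β)

theorem measurable_symbol {m : ℕ} (β : ℂ) : Measurable (symbol (m := m) β) :=
  (Complex.measurable_ofReal.comp (measurable_norm.const_mul _)).pow_const _

theorem norm_symbol {m : ℕ} (β : ℂ) {ξ : Eu m} (hξ : ξ ≠ 0) :
    ‖symbol β ξ‖ = (2 * Real.pi) ^ (2 * β.re) * ‖ξ‖ ^ (2 * β.re) := by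
  have := norm_pos_iff.2 hξ
  rw [symbol, Complex.norm_cpow_eq_rpow_re_of_pos (by positivity), Real.mul_rpow (by positivity)
    (by positivity)]
  simp

theorem symbol_add {m : ℕ} (α β : ℂ) {ξ : Eu m} (hξ : ξ ≠ 0) :
    symbol (α + β) ξ = symbol α ξ * symbol β ξ := by
  have := norm_pos_iff.2 hξ
  rw [symbol, symbol, symbol, ← Complex.cpow_add _ _ (Complex.ofReal_ne_zero.2 (by positivity)),
    mul_add]

theorem symbol_natCast {m : ℕ} (k : ℕ) (ξ : Eu m) :
    symbol (k : ℂ) ξ = ((2 * Real.pi * ‖ξ‖ : ℝ) : ℂ) ^ (2 * k) := by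
  rw [symbol, ← Complex.cpow_natCast]
  push_cast; rfl

theorem continuousAt_symbol {m : ℕ} (β : ℂ) {ξ : Eu m} (hξ : ξ ≠ 0) :
    ContinuousAt (symbol β) ξ := by
  have := norm_pos_iff.2 hξ
  refine ContinuousAt.comp (f := fun ξ : Eu m => ((2 * Real.pi * ‖ξ‖ : ℝ) : ℂ))
    (continuousAt_cpow_const (Or.inl ?_)) (by fun_prop)
  rw [Complex.ofReal_re]
  positivity

theorem integrable_symbol_mul {m : ℕ} (hm : 1 ≤ m) {β : ℂ} (hβ : -(m : ℝ) / 2 < β.re)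
    (χ : 𝓢(Eu m, ℂ)) : Integrable (fun ξ : Eu m => symbol β ξ * χ ξ) := by
  refine ((integrable_norm_rpow_mul hm (s := 2 * β.re) (by linarith) χ).const_mul
    ((2 * Real.pi) ^ (2 * β.re))).mono
    ((measurable_symbol β).mul χ.continuous.measurable).aestronglyMeasurable ?_
  filter_upwards [ae_ne_zero hm] with ξ hξ
  rw [norm_mul, norm_symbol β hξ, Real.norm_of_nonneg (by positivity), mul_assoc]

/-- The functional `φ ↦ ∫ (2π|ξ|)^(2β) φ̂(ξ) dξ`. -/
noncomputable def fourierPairing {m : ℕ} (β : ℂ) (φ : 𝓢(Eu m, ℂ)) : ℂ :=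
  ∫ ξ : Eu m, symbol β ξ * (𝓕 φ) ξ

/-- Near β₀ the modulus of the symbol is dominated by the sum of its moduli at β₀ - ε and β₀ + ε:
the first wins where 2π|ξ| ≤ 1, the second where 2π|ξ| ≥ 1. -/
theorem differentiableOn_fourierPairing {m : ℕ} (hm : 1 ≤ m) (φ : 𝓢(Eu m, ℂ)) :
    DifferentiableOn ℂ (fun β => fourierPairing β φ) {β : ℂ | -(m : ℝ) / 2 < β.re} := by
  have hopen : IsOpen {β : ℂ | -(m : ℝ) / 2 < β.re} := isOpen_lt (by fun_prop) (by fun_prop)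
  refine differentiableOn_integral_of_locally_dominated hopen ?_ ?_ ?_
  · exact fun β hβ => (integrable_symbol_mul hm hβ (𝓕 φ)).aestronglyMeasurable
  · filter_upwards [ae_ne_zero hm] with ξ hξ
    have := norm_pos_iff.2 hξ
    have h := differentiable_cpow_affine (c := ((2 * Real.pi * ‖ξ‖ : ℝ) : ℂ))
      (Complex.ofReal_ne_zero.2 (by positivity)) 2 0
    simp only [add_zero] at h
    exact (h.mul_const _).differentiableOn
  · intro β₀ hβ₀
    have hβ₀' : -(m : ℝ) / 2 < β₀.re := hβ₀
    obtain ⟨ε, hε, hεm⟩ : ∃ ε > 0, -(m : ℝ) / 2 < β₀.re - ε :=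
      ⟨(β₀.re + m / 2) / 2, by linarith, by linarith⟩
    have h1 := integrable_symbol_mul hm (β := β₀ - ε) (by simpa using hεm) (𝓕 φ)
    have h2 := integrable_symbol_mul hm (β := β₀ + ε) (by simp; linarith) (𝓕 φ)
    refine ⟨ε, hε, _, h1.norm.add h2.norm, ?_⟩
    filter_upwards [ae_ne_zero hm] with ξ hξ β hβ
    have hξ0 := norm_pos_iff.2 hξ
    have hb : |(β - β₀).re| < ε := (Complex.abs_re_le_norm _).trans_lt (by
      rwa [Metric.mem_ball, dist_eq_norm] at hβ)
    rw [Complex.sub_re, abs_lt] at hb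
    have hx : 0 < 2 * Real.pi * ‖ξ‖ := by positivity
    simp only [Pi.add_apply, norm_mul]
    rw [← add_mul]
    gcongr
    simp only [symbol, Complex.norm_cpow_eq_rpow_re_of_pos hx]
    have n1 := Real.rpow_nonneg hx.le (2 * (β₀ - ε)).re
    have n2 := Real.rpow_nonneg hx.le (2 * (β₀ + ε)).re
    rcases le_total (2 * Real.pi * ‖ξ‖) 1 with h | h
    · have := Real.rpow_le_rpow_of_exponent_ge hx h (y := (2 * β).re) (z := (2 * (β₀ - ε)).re)
        (by simp; linarith)
      linarith
    · have := Real.rpow_le_rpow_of_exponent_le h (y := (2 * β).re) (z := (2 * (β₀ + ε)).re)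
        (by simp; linarith)
      linarith

theorem fourier_neg_laplacian_apply {m : ℕ} (φ : 𝓢(Eu m, ℂ)) (ξ : Eu m) :
    (𝓕 (-Δ φ)) ξ = ((2 * Real.pi * ‖ξ‖ : ℝ) : ℂ) ^ 2 * (𝓕 φ) ξ := by
  have hg : (fun ξ : Eu m => ‖ξ‖ ^ 2).HasTemperateGrowth := by fun_prop
  rw [SchwartzMap.laplacian_eq_fourierMultiplierCLM, SchwartzMap.fourierMultiplierCLM_apply,
    neg_smul, neg_neg, FourierTransform.fourier_smul, FourierTransform.fourier_fourierInv_eq]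
  rw [_root_.smul_apply]
  have : (SchwartzMap.smulLeftCLM ℂ ((‖·‖ ^ 2 : Eu m → ℝ)) (𝓕 φ)) ξ = (‖ξ‖ ^ 2) • (𝓕 φ) ξ :=
    SchwartzMap.smulLeftCLM_apply_apply hg _ _
  rw [this]
  simp only [Complex.real_smul]
  push_cast
  ring

theorem fourier_iterate_neg_laplacian_apply {m : ℕ} (k : ℕ) (φ : 𝓢(Eu m, ℂ)) (ξ : Eu m) :
    (𝓕 ((fun χ : 𝓢(Eu m, ℂ) => -Δ χ)^[k] φ)) ξ = symbol (k : ℂ) ξ * (𝓕 φ) ξ := by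
  rw [symbol_natCast]
  induction k with
  | zero => simp
  | succ k ih =>
    rw [Function.iterate_succ_apply', fourier_neg_laplacian_apply, ih]
    ring

theorem negLaplacianPowDelta_apply {m : ℕ} (k : ℕ) (φ : 𝓢(Eu m, ℂ)) :
    negLaplacianPowDelta m k φ = (fun χ : 𝓢(Eu m, ℂ) => -Δ χ)^[k] φ 0 := by
  have h (S : 𝓢'(Eu m, ℂ)) : ((fun S : 𝓢'(Eu m, ℂ) => -Δ S)^[k] S) φ =
      S ((fun χ : 𝓢(Eu m, ℂ) => -Δ χ)^[k] φ) := by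
    induction k generalizing S φ with
    | zero => rfl
    | succ k ih =>
      rw [Function.iterate_succ_apply', Function.iterate_succ_apply]
      have : (-Δ ((fun S : 𝓢'(Eu m, ℂ) => -Δ S)^[k] S)) φ =
        ((fun S : 𝓢'(Eu m, ℂ) => -Δ S)^[k] S) (-Δ φ) := by
        rw [map_neg, ← TemperedDistribution.laplacian_apply_apply]; rfl
      rw [this, ih]
  rw [negLaplacianPowDelta, h]
  rfl

/-- The left side is the value at 0 of the iterated negative Laplacian of `φ`; Fourier inversion
writes it as the integral of its transform. -/
theorem kernel_natCast_eq_fourierPairing {m : ℕ} (hm : 1 ≤ m) (k : ℕ) (φ : 𝓢(Eu m, ℂ)) :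
    kernel m k φ = fourierPairing (k : ℂ) φ := by
  rw [kernel_natCast hm, negLaplacianPowDelta_apply, fourierPairing]
  simp only [← fourier_iterate_neg_laplacian_apply]
  set χ := (fun χ : 𝓢(Eu m, ℂ) => -Δ χ)^[k] φ
  have h : (𝓕⁻ (𝓕 χ)) 0 = χ 0 := by rw [FourierTransform.fourierInv_fourier_eq]
  rw [← h, SchwartzMap.fourierInv_coe, Real.fourierInv_eq]
  simp

/-! ### Gaussian subordination -/

/-- Self-adjointness of the Fourier transform, applied to a Gaussian whose transform is again a
Gaussian with `t` replaced by its inverse. -/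
theorem integral_gaussian_mul {m : ℕ} {t : ℝ} (ht : 0 < t) (φ : 𝓢(Eu m, ℂ)) :
    ∫ y : Eu m, Complex.exp (-((Real.pi * ‖y‖ ^ 2 : ℝ) * t)) * φ y =
      (t : ℂ) ^ (-((m : ℂ) / 2)) *
        ∫ ξ : Eu m, Complex.exp (-((Real.pi * ‖ξ‖ ^ 2 : ℝ) * (t⁻¹ : ℝ))) * (𝓕 φ) ξ := by
  have htc : (t : ℂ) ≠ 0 := Complex.ofReal_ne_zero.2 ht.ne'
  have hpi : (Real.pi : ℂ) ≠ 0 := Complex.ofReal_ne_zero.2 Real.pi_ne_zero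
  have hb : 0 < ((Real.pi * t⁻¹ : ℝ) : ℂ).re := by
    rw [Complex.ofReal_re]; have := Real.pi_pos; positivity
  set g : Eu m → ℂ := fun v => Complex.exp (-((Real.pi * t⁻¹ : ℝ) : ℂ) * ‖v‖ ^ 2) with hg
  have hint : Integrable g := by
    simpa [hg] using GaussianFourier.integrable_cexp_neg_mul_sq_norm_add hb 0 (0 : Eu m)
  have hself : ∫ ξ : Eu m, (𝓕 g) ξ • φ ξ = ∫ x : Eu m, g x • (𝓕 (φ : Eu m → ℂ)) x := by
    simpa using! (VectorFourier.integral_fourierIntegral_smul_eq_flip (L := innerₗ (Eu m))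
      Real.continuous_fourierChar continuous_inner hint φ.integrable)
  have hF (w : Eu m) : (𝓕 g) w = (t : ℂ) ^ ((m : ℂ) / 2) *
      Complex.exp (-((Real.pi * ‖w‖ ^ 2 : ℝ) * t)) := by
    rw [hg, fourier_gaussian_innerProductSpace hb]
    congr 1
    · rw [finrank_euclideanSpace, Fintype.card_fin]
      congr 1
      push_cast
      field_simp
    · congr 1
      push_cast
      field_simp
  have hg' (x : Eu m) : g x = Complex.exp (-((Real.pi * ‖x‖ ^ 2 : ℝ) * (t⁻¹ : ℝ))) := by
    simp only [hg]
    congr 1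
    push_cast
    ring
  simp only [hF, hg', smul_eq_mul, mul_assoc, ← SchwartzMap.fourier_coe] at hself
  rw [integral_const_mul] at hself
  rw [← hself, ← mul_assoc, ← Complex.cpow_add _ _ htc]
  simp

/-- Fubini and the Gamma integral in t. The bound Re s > 0 is for the Gamma integral, and Re s < m/2
for the integrability of |y|^(-2s) at the origin. -/
theorem mellin_integral_gaussian_mul {m : ℕ} (hm : 1 ≤ m) {s : ℂ} (hs : 0 < s.re)
    (hs' : s.re < (m : ℝ) / 2) (χ : 𝓢(Eu m, ℂ)) :
    mellin (fun t : ℝ => ∫ y : Eu m, Complex.exp (-((Real.pi * ‖y‖ ^ 2 : ℝ) * t)) * χ y) s =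
      Complex.Gamma s * (Real.pi : ℂ) ^ (-s) * ∫ y : Eu m, (‖y‖ : ℂ) ^ (-2 * s) * χ y := by
  have hpi := Real.pi_pos
  set f : ℝ → Eu m → ℂ := fun t y =>
    (t : ℂ) ^ (s - 1) * (Complex.exp (-((Real.pi * ‖y‖ ^ 2 : ℝ) * t)) * χ y) with hf
  have hmeas : AEStronglyMeasurable (Function.uncurry f)
      ((volume.restrict (Ioi (0 : ℝ))).prod (volume : Measure (Eu m))) := by
    refine Measurable.aestronglyMeasurable ?_
    have h1 : Measurable (fun p : ℝ × Eu m => (p.1 : ℂ) ^ (s - 1)) :=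
      (Complex.measurable_ofReal.comp measurable_fst).pow_const _
    have h2 : Continuous (fun p : ℝ × Eu m =>
        Complex.exp (-((Real.pi * ‖p.2‖ ^ 2 : ℝ) * p.1)) * χ p.2) := by
      have := χ.continuous
      fun_prop
    exact h1.mul h2.measurable
  have hnorm (y : Eu m) {t : ℝ} (ht : t ∈ Ioi (0 : ℝ)) :
      ‖f t y‖ = t ^ (s.re - 1) * Real.exp (-(Real.pi * ‖y‖ ^ 2 * t)) * ‖χ y‖ := by
    simp only [hf, norm_mul, Complex.norm_cpow_eq_rpow_re_of_pos ht, Complex.norm_exp]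
    rw [← mul_assoc]
    congr 3
    rw [← Complex.ofReal_mul, ← Complex.ofReal_neg, Complex.ofReal_re]
  have hGint {a : ℝ} (ha : 0 < a) :
      IntegrableOn (fun t : ℝ => t ^ (s.re - 1) * Real.exp (-(a * t))) (Ioi 0) := by
    have := integrableOn_rpow_mul_exp_neg_mul_rpow (p := 1) (s := s.re - 1) (b := a)
      (by linarith) one_pos ha
    simpa [neg_mul] using this
  have hswap : Integrable (Function.uncurry f)
      ((volume.restrict (Ioi (0 : ℝ))).prod (volume : Measure (Eu m))) := by
    rw [integrable_prod_iff' hmeas]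
    constructor
    · filter_upwards [ae_ne_zero hm] with y hy
      have := norm_pos_iff.2 hy
      refine ((hGint (a := Real.pi * ‖y‖ ^ 2) (by positivity)).mul_const ‖χ y‖).mono' ?_ ?_
      · refine Measurable.aestronglyMeasurable ?_
        have h1 : Measurable (fun t : ℝ => (t : ℂ) ^ (s - 1)) :=
          Complex.measurable_ofReal.pow_const _
        exact h1.mul (by fun_prop)
      · exact (ae_restrict_iff' measurableSet_Ioi).2 (.of_forall fun t ht => (hnorm y ht).le)
    · refine ((integrable_norm_rpow_mul hm (s := -2 * s.re) (by linarith) χ).const_mul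
        (Real.pi ^ (-s.re) * Real.Gamma s.re)).congr ?_
      filter_upwards [ae_ne_zero hm] with y hy
      have := norm_pos_iff.2 hy
      simp only [Function.uncurry]
      rw [setIntegral_congr_fun measurableSet_Ioi fun t ht => hnorm y ht, integral_mul_const,
        Real.integral_rpow_mul_exp_neg_mul_Ioi hs (by positivity), one_div,
        Real.inv_rpow (by positivity), ← Real.rpow_neg (by positivity),
        Real.mul_rpow (by positivity) (by positivity), ← Real.rpow_natCast,
        ← Real.rpow_mul (by positivity)]
      rw [show ((2 : ℕ) : ℝ) * -s.re = -2 * s.re by push_cast; ring]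
      ring
  simp only [mellin, smul_eq_mul, ← integral_const_mul]
  rw [integral_integral_swap (f := f) hswap]
  refine integral_congr_ae ?_
  filter_upwards [ae_ne_zero hm] with y hy
  have hy0 := norm_pos_iff.2 hy
  have hr : 0 < Real.pi * ‖y‖ ^ 2 := by positivity
  have h1 := Complex.integral_cpow_mul_exp_neg_mul_Ioi hs hr
  simp only [hf, ← mul_assoc]
  rw [integral_mul_const, h1]
  congr 1
  have e : (1 / ((Real.pi * ‖y‖ ^ 2 : ℝ) : ℂ)) ^ s =
      (Real.pi : ℂ) ^ (-s) * (‖y‖ : ℂ) ^ (-2 * s) := by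
    rw [one_div, Complex.inv_cpow _ _ (by rw [Complex.arg_ofReal_of_nonneg hr.le]; exact hpi.ne),
      ← Complex.cpow_neg, Complex.ofReal_mul, Complex.mul_cpow_ofReal_nonneg hpi.le (by positivity),
      Complex.ofReal_pow, ← Complex.cpow_nat_mul']
    · congr 2; push_cast; ring
    · rw [Complex.arg_ofReal_of_nonneg hy0.le]; simpa using hpi
    · rw [Complex.arg_ofReal_of_nonneg hy0.le]; simpa using hpi.le
  rw [e]
  ring

/-- This is Riemann's argument for a functional equation: the Gaussian pairings of φ and φ̂ are
exchanged by t ↦ 1/t up to a factor t^(-m/2). Their Mellin transforms at m/2 + β and -β therefore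
agree, and each is a Gamma factor times an absolutely convergent Riesz integral. -/
theorem kernel_eq_fourierPairing_of_strip {m : ℕ} (hm : 1 ≤ m) {β : ℂ}
    (h1 : -(m : ℝ) / 2 < β.re) (h2 : β.re < 0) (φ : 𝓢(Eu m, ℂ)) :
    kernel m β φ = fourierPairing β φ := by
  have hpi : (Real.pi : ℂ) ≠ 0 := Complex.ofReal_ne_zero.2 Real.pi_ne_zero
  have hβ : ∀ n : ℕ, β ≠ n := by
    rintro n rfl
    simp only [Complex.natCast_re] at h2
    linarith [(Nat.cast_nonneg n : (0 : ℝ) ≤ n)]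
  have hre : ((m : ℂ) / 2 + β).re = m / 2 + β.re := by
    rw [Complex.add_re, show (m : ℂ) / 2 = ((m / 2 : ℝ) : ℂ) by push_cast; rfl, Complex.ofReal_re]
  have hA := mellin_integral_gaussian_mul hm (s := (m : ℂ) / 2 + β) (by rw [hre]; linarith)
    (by rw [hre]; linarith) φ
  have hB := mellin_integral_gaussian_mul hm (s := -β) (by simpa using h2)
    (by rw [Complex.neg_re]; linarith) (𝓕 φ)
  have hC : mellin (fun t : ℝ => ∫ y : Eu m, Complex.exp (-((Real.pi * ‖y‖ ^ 2 : ℝ) * t)) * φ y)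
      ((m : ℂ) / 2 + β) =
      mellin (fun t : ℝ => ∫ y : Eu m, Complex.exp (-((Real.pi * ‖y‖ ^ 2 : ℝ) * t)) * (𝓕 φ) y)
      (-β) := by
    have h := mellin_cpow_smul (fun t : ℝ => ∫ y : Eu m,
      Complex.exp (-((Real.pi * ‖y‖ ^ 2 : ℝ) * (t⁻¹ : ℝ))) * (𝓕 φ) y) ((m : ℂ) / 2 + β)
      (-((m : ℂ) / 2))
    rw [show (m : ℂ) / 2 + β + -((m : ℂ) / 2) = β by ring] at h
    rw [← mellin_comp_inv, ← h]
    refine setIntegral_congr_fun measurableSet_Ioi fun t ht => ?_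
    simp only [smul_eq_mul]
    rw [integral_gaussian_mul ht φ]
  rw [hA, hB, neg_neg] at hC
  have hJ : fourierPairing β φ = (2 : ℂ) ^ (2 * β) * ((Real.pi : ℂ) ^ β * (Real.pi : ℂ) ^ β) *
      ∫ y : Eu m, (‖y‖ : ℂ) ^ (-2 * -β) * (𝓕 φ) y := by
    rw [fourierPairing, ← integral_const_mul]
    congr 1
    ext ξ
    rw [symbol, Complex.ofReal_mul, Complex.mul_cpow_ofReal_nonneg (by have := Real.pi_pos; positivity)
      (norm_nonneg _), Complex.ofReal_mul, Complex.mul_cpow_ofReal_nonneg (by norm_num)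
      Real.pi_pos.le, ← Complex.cpow_add _ _ hpi, Complex.ofReal_ofNat, ← two_mul, neg_mul_neg]
    ring
  have hG : Complex.Gamma (-β) ≠ 0 := by
    have := ne_natCast_iff.1 hβ
    rwa [ne_eq, inv_eq_zero] at this
  rw [kernel_apply hβ, radialPairing_eq_integral hm h2, hJ, rieszConst,
    show -(m : ℂ) - 2 * β = -2 * (m / 2 + β) by ring]
  have hP : (Real.pi : ℂ) ^ (-((m : ℂ) / 2)) = (Real.pi : ℂ) ^ (-((m : ℂ) / 2 + β)) *
      (Real.pi : ℂ) ^ β := by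
    rw [← Complex.cpow_add _ _ hpi]; congr 1; ring
  rw [hP]
  calc _ = (2 : ℂ) ^ (2 * β) * (Real.pi : ℂ) ^ β * (Complex.Gamma (-β))⁻¹ *
        (Complex.Gamma ((m : ℂ) / 2 + β) * (Real.pi : ℂ) ^ (-((m : ℂ) / 2 + β)) *
          ∫ y : Eu m, (‖y‖ : ℂ) ^ (-2 * ((m : ℂ) / 2 + β)) * φ y) := by ring
    _ = _ := by rw [hC]; field_simp

theorem kernel_eq_fourierPairing {m : ℕ} (hm : 1 ≤ m) {β : ℂ}
    (hβ : -(m : ℝ) / 2 < β.re) (φ : 𝓢(Eu m, ℂ)) : kernel m β φ = fourierPairing β φ := by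
  by_cases hn : ∀ n : ℕ, β ≠ n
  · have hU : {z : ℂ | -(m : ℝ) / 2 < z.re} \ {β : ℂ | ¬ ∀ n : ℕ, β ≠ n} =
        {z : ℂ | -(m : ℝ) / 2 < z.re} ∩ {β : ℂ | ∀ n : ℕ, β ≠ n} := by
      ext; simp
    have hc := isPreconnected_halfPlane_diff_countable (-(m : ℝ) / 2) countable_setOf_natCast
    rw [hU] at hc
    have hopen : IsOpen ({z : ℂ | -(m : ℝ) / 2 < z.re} ∩ {β : ℂ | ∀ n : ℕ, β ≠ n}) :=
      (isOpen_lt (by fun_prop) (by fun_prop)).inter isOpen_setOf_ne_natCast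
    have hm' : (0 : ℝ) < m := by exact_mod_cast hm
    refine eqOn_of_differentiableOn_of_eqOn_open hopen hc
      (f := fun β => kernel m β φ) (g := fun β => fourierPairing β φ)
      ((differentiableOn_kernel_of_ne hm φ).mono fun z hz => ⟨admissible_of_re hz.1, hz.2⟩)
      ((differentiableOn_fourierPairing hm φ).mono inter_subset_left)
      (V := {z : ℂ | z.re < 0}) (isOpen_lt (by fun_prop) (by fun_prop)) ?_ ?_ ⟨hβ, hn⟩
    -- The midpoint of the strip -m/2 < Re z < 0.
    · refine ⟨((-(m : ℝ) / 4 : ℝ) : ℂ), ⟨?_, fun n hn => ?_⟩, ?_⟩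
      · rw [mem_ofPred_eq, Complex.ofReal_re]; linarith
      · have := congrArg Complex.re hn
        rw [Complex.ofReal_re, Complex.natCast_re] at this
        linarith [(Nat.cast_nonneg n : (0 : ℝ) ≤ n)]
      · rw [mem_ofPred_eq, Complex.ofReal_re]; linarith
    · exact fun z hz => kernel_eq_fourierPairing_of_strip hm hz.1.1 hz.2 φ
  · push Not at hn
    obtain ⟨n, rfl⟩ := hn
    exact kernel_natCast_eq_fourierPairing hm n φ

/-- At a natural number the formula with 1/Γ(-β) is unavailable, but in the half-plane Re β > -m/2
the kernel equals the holomorphic Fourier pairing. -/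
theorem differentiableOn_kernel {m : ℕ} (hm : 1 ≤ m) (φ : 𝓢(Eu m, ℂ)) :
    DifferentiableOn ℂ (fun β => kernel m β φ) {β : ℂ | Admissible m β} := by
  intro β hβ
  by_cases hn : ∀ n : ℕ, β ≠ n
  · exact ((differentiableOn_kernel_of_ne hm φ).differentiableAt
      (((isOpen_setOf_admissible m).inter isOpen_setOf_ne_natCast).mem_nhds
        ⟨hβ, hn⟩)).differentiableWithinAt
  · push Not at hn
    obtain ⟨n, rfl⟩ := hn
    have hm' : (0 : ℝ) < m := by exact_mod_cast hm
    have hopen : IsOpen {β : ℂ | -(m : ℝ) / 2 < β.re} := isOpen_lt (by fun_prop) (by fun_prop)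
    have hmem : (n : ℂ) ∈ {β : ℂ | -(m : ℝ) / 2 < β.re} := by
      rw [mem_ofPred_eq, Complex.natCast_re]
      linarith [(Nat.cast_nonneg n : (0 : ℝ) ≤ n)]
    refine (((differentiableOn_fourierPairing hm φ).differentiableAt
      (hopen.mem_nhds hmem)).congr_of_eventuallyEq ?_).differentiableWithinAt
    filter_upwards [hopen.mem_nhds hmem] with z hz using kernel_eq_fourierPairing hm hz φ

end RieszKernel

namespace RieszKernel

open MeasureTheory Set Filter Topology
open scoped SchwartzMap Laplacian FourierTransform

/-! ### Decay of the regularized kernels -/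

/-- Only derivatives on [0, 1] enter here. Global seminorms of a translate would not register its
decay as the translation vector grows. -/
theorem norm_rayRem_le_of_le {m : ℕ} (φ : 𝓢(Eu m, ℂ)) {B : ℝ} (N : ℕ) :
    ∀ j : ℕ, (∀ r ∈ Icc (0 : ℝ) 1, ‖rayDeriv (j + N) φ r‖ ≤ B) →
      ∀ r ∈ Icc (0 : ℝ) 1, ‖rayRem N j φ r‖ ≤ B * r ^ N := by
  induction N with
  | zero => intro j h r hr; simpa [rayRem] using h r hr
  | succ N ih =>
    intro j h r hr
    have hB : 0 ≤ B := (norm_nonneg _).trans (h 0 (by simp))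
    have h' : ∀ r ∈ Icc (0 : ℝ) 1, ‖rayDeriv (j + 1 + N) φ r‖ ≤ B := by
      rwa [show j + 1 + N = j + (N + 1) by ring]
    have h0 : rayRem (N + 1) j φ 0 = 0 := by
      simp [rayRem, Finset.sum_range_succ']
    have := norm_image_sub_le_of_norm_deriv_le_segment' (a := 0) (b := r)
      (f := rayRem (N + 1) j φ) (f' := rayRem N (j + 1) φ) (C := B * r ^ N)
      (fun x _ => (hasDerivAt_rayRem N j φ x).hasDerivWithinAt)
      (fun x hx => (ih (j + 1) h' x ⟨hx.1, hx.2.le.trans hr.2⟩).trans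
        (by gcongr; exacts [hx.1, hx.2.le])) r ⟨hr.1, le_rfl⟩
    rw [h0, sub_zero, sub_zero] at this
    rw [pow_succ, ← mul_assoc]
    exact this

theorem one_add_norm_mul {m : ℕ} (x y : Eu m) : 1 + ‖x + y‖ ≤ (1 + ‖x‖) * (1 + ‖y‖) := by
  nlinarith [norm_add_le x y, mul_nonneg (norm_nonneg x) (norm_nonneg y)]

/-- Near the origin the translates of a Schwartz function are rapidly decreasing. -/
theorem exists_rayDeriv_translate_le {m : ℕ} (φ : 𝓢(Eu m, ℂ)) (k M : ℕ) :
    ∃ C : ℝ, 0 ≤ C ∧ ∀ x : Eu m, ∀ r ∈ Icc (0 : ℝ) 1,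
      ‖rayDeriv k (SchwartzMap.compSubConstCLM ℂ x φ) r‖ ≤ C * ((1 + ‖x‖) ^ M)⁻¹ := by
  set D : ℝ := 2 ^ M * (Finset.Iic (M, k)).sup (fun p => SchwartzMap.seminorm ℂ p.1 p.2) φ with hD
  have hD0 : 0 ≤ D := by positivity
  refine ⟨2 ^ M * D * (surf m).real univ, by positivity, fun x r hr => ?_⟩
  have h : ∀ ω : Metric.sphere (0 : Eu m) 1, ‖iteratedDeriv k (fun t : ℝ =>
      SchwartzMap.compSubConstCLM ℂ x φ (t • (ω : Eu m))) r‖ ≤ 2 ^ M * D * ((1 + ‖x‖) ^ M)⁻¹ := by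
    intro ω
    rw [iteratedDeriv_ray]
    refine (ContinuousMultilinearMap.le_opNorm _ _).trans ?_
    have e : (SchwartzMap.compSubConstCLM ℂ x φ : Eu m → ℂ) = fun y => φ (y - x) := rfl
    rw [e, iteratedFDeriv_comp_sub]
    have h1 := SchwartzMap.one_add_le_sup_seminorm_apply (𝕜 := ℂ) (m := (M, k)) le_rfl le_rfl φ
      (r • (ω : Eu m) - x)
    have h2 : (1 + ‖x‖) ≤ 2 * (1 + ‖r • (ω : Eu m) - x‖) := by
      have := norm_sub_le (r • (ω : Eu m)) (r • (ω : Eu m) - x)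
      rw [sub_sub_cancel] at this
      have hn : ‖r • (ω : Eu m)‖ ≤ 1 := by
        rw [norm_smul, norm_eq_of_mem_sphere, mul_one, Real.norm_of_nonneg hr.1]; exact hr.2
      linarith [norm_nonneg (r • (ω : Eu m) - x)]
    have h3 : (1 + ‖x‖) ^ M ≤ 2 ^ M * (1 + ‖r • (ω : Eu m) - x‖) ^ M := by
      rw [← mul_pow]; gcongr
    simp only [norm_eq_of_mem_sphere, Finset.prod_const_one, mul_one]
    rw [← div_eq_mul_inv, le_div_iff₀ (by positivity)]
    calc _ ≤ ‖iteratedFDeriv ℝ k φ (r • (ω : Eu m) - x)‖ *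
          (2 ^ M * (1 + ‖r • (ω : Eu m) - x‖) ^ M) := by gcongr
      _ = 2 ^ M * ((1 + ‖r • (ω : Eu m) - x‖) ^ M *
          ‖iteratedFDeriv ℝ k φ (r • (ω : Eu m) - x)‖) := by ring
      _ ≤ 2 ^ M * D := by gcongr
  refine (norm_integral_le_of_norm_le_const (.of_forall h)).trans_eq ?_
  ring

/-- Only values of the translate near the unit ball matter, so the decay is faster than any power.
Uniformity in β near β₀ is needed later for domination. -/
theorem exists_nearPart_translate_le {m : ℕ} (φ : 𝓢(Eu m, ℂ)) {β₀ : ℂ}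
    (hβ₀ : ∀ n : ℕ, β₀ ≠ n) {N : ℕ} (hN : 2 * β₀.re + 1 < N) (M : ℕ) :
    ∃ C : ℝ, 0 ≤ C ∧ ∀ᶠ β in 𝓝 β₀, ∀ x : Eu m,
      ‖nearPart N β (SchwartzMap.compSubConstCLM ℂ x φ)‖ ≤ C * ((1 + ‖x‖) ^ M)⁻¹ := by
  choose C hC0 hC using fun k => exists_rayDeriv_translate_le φ k M
  -- Only even `k`: β₀ may equal k/2 for an odd k, but then the Taylor coefficient is zero.
  have hcont : ∀ k : ℕ, Even k → ∃ D : ℝ, 0 ≤ D ∧ ∀ᶠ β in 𝓝 β₀, ‖((k : ℂ) - 2 * β)⁻¹‖ ≤ D := by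
    rintro k ⟨l, rfl⟩
    have h0 : (((l + l : ℕ) : ℂ) - 2 * β₀) ≠ 0 := fun h => by
      refine hβ₀ l ?_
      push_cast at h
      linear_combination (-1 / 2 : ℂ) * h
    have hc : ContinuousAt (fun β : ℂ => ‖(((l + l : ℕ) : ℂ) - 2 * β)⁻¹‖) β₀ :=
      (ContinuousAt.inv₀ (f := fun β : ℂ => ((l + l : ℕ) : ℂ) - 2 * β) (by fun_prop) h0).norm
    refine ⟨‖(((l + l : ℕ) : ℂ) - 2 * β₀)⁻¹‖ + 1, by positivity, ?_⟩
    filter_upwards [hc.eventually_lt (g := fun _ => ‖(((l + l : ℕ) : ℂ) - 2 * β₀)⁻¹‖ + 1)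
      continuousAt_const (by simp)] with β hβ using hβ.le
  have hterm : ∀ k : ℕ, ∃ E : ℝ, 0 ≤ E ∧ ∀ᶠ β in 𝓝 β₀, ∀ x : Eu m,
      ‖rayDeriv k (SchwartzMap.compSubConstCLM ℂ x φ) 0 / (Nat.factorial k : ℂ) / (k - 2 * β)‖ ≤
        E * ((1 + ‖x‖) ^ M)⁻¹ := by
    intro k
    rcases Nat.even_or_odd k with hk | hk
    · obtain ⟨D, hD0, hD⟩ := hcont k hk
      refine ⟨C k * D, mul_nonneg (hC0 k) hD0, ?_⟩
      filter_upwards [hD] with β hβ x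
      have hf : (1 : ℝ) ≤ (Nat.factorial k : ℝ) := by exact_mod_cast Nat.factorial_pos k
      have h1 := hC k x 0 (by simp)
      rw [div_eq_mul_inv _ ((k : ℂ) - 2 * β), norm_mul, norm_div, Complex.norm_natCast]
      calc _ ≤ ‖rayDeriv k (SchwartzMap.compSubConstCLM ℂ x φ) 0‖ * D := by
            gcongr
            exact div_le_self (norm_nonneg _) hf
        _ ≤ C k * ((1 + ‖x‖) ^ M)⁻¹ * D := by gcongr
        _ = _ := by ring
    · refine ⟨0, le_rfl, .of_forall fun β x => ?_⟩
      simp [rayDeriv_zero_of_odd hk]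
  choose E hE0 hE using hterm
  have hopen : IsOpen {β : ℂ | 2 * β.re + 1 < N} := isOpen_lt (by fun_prop) (by fun_prop)
  refine ⟨C N + ∑ k ∈ Finset.range N, E k,
    add_nonneg (hC0 N) (Finset.sum_nonneg fun k _ => hE0 k), ?_⟩
  filter_upwards [hopen.mem_nhds hN, (Finset.range N).eventually_all.2 fun k _ => hE k]
    with β hβ hβE x
  have hβ' : 2 * β.re + 1 < N := hβ
  rw [nearPart, add_mul, Finset.sum_mul]
  refine (norm_add_le _ _).trans (add_le_add ?_ ((norm_sum_le _ _).trans
    (Finset.sum_le_sum fun k hk => hβE k hk x)))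
  have hint := norm_setIntegral_le_of_norm_le_const (μ := volume) (s := Ioc (0 : ℝ) 1)
    (f := fun r : ℝ => (r : ℂ) ^ (-2 * β - 1) * rayRem N 0 (SchwartzMap.compSubConstCLM ℂ x φ) r)
    (C := C N * ((1 + ‖x‖) ^ M)⁻¹) (by simp) fun r hr => ?_
  · simpa using hint
  · have h := norm_rayRem_le_of_le (SchwartzMap.compSubConstCLM ℂ x φ) N 0
      (by simpa using hC N x) r (Ioc_subset_Icc_self hr)
    have hp : ‖(r : ℂ) ^ (-2 * β - 1)‖ ≤ r ^ (-(N : ℝ)) :=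
      norm_cpow_le_of_le_one hr (by simp; linarith)
    have hrN : r ^ (-(N : ℝ)) * r ^ N = 1 := by
      rw [← Real.rpow_natCast r N, ← Real.rpow_add hr.1]; simp
    have hnn : 0 ≤ r ^ (-(N : ℝ)) := Real.rpow_nonneg hr.1.le _
    rw [norm_mul]
    calc _ ≤ r ^ (-(N : ℝ)) * (C N * ((1 + ‖x‖) ^ M)⁻¹ * r ^ N) := by gcongr
      _ = C N * ((1 + ‖x‖) ^ M)⁻¹ * (r ^ (-(N : ℝ)) * r ^ N) := by ring
      _ = _ := by rw [hrN, mul_one]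

/-- Peetre's inequality. -/
theorem one_add_norm_rpow_le {m : ℕ} (x y : Eu m) {s : ℝ} {S : ℕ} (hs : |s| ≤ S) :
    (1 + ‖y‖) ^ s ≤ (1 + ‖x‖) ^ s * (1 + ‖y - x‖) ^ S := by
  have hx : 0 < 1 + ‖x‖ := by positivity
  have hy : 0 < 1 + ‖y‖ := by positivity
  have hd : 1 ≤ 1 + ‖y - x‖ := by linarith [norm_nonneg (y - x)]
  rw [← Real.rpow_natCast]
  refine le_trans ?_ (mul_le_mul_of_nonneg_left (Real.rpow_le_rpow_of_exponent_le hd hs)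
    (Real.rpow_nonneg hx.le _))
  rcases le_total 0 s with h | h
  · rw [abs_of_nonneg h, ← Real.mul_rpow hx.le (by positivity)]
    refine Real.rpow_le_rpow hy.le ?_ h
    simpa using one_add_norm_mul x (y - x)
  · rw [abs_of_nonpos h, Real.rpow_neg (by positivity), ← div_eq_mul_inv,
      le_div_iff₀ (Real.rpow_pos_of_pos (by positivity) _), ← Real.mul_rpow hy.le (by positivity)]
    refine Real.rpow_le_rpow_of_nonpos hx ?_ h
    have := one_add_norm_mul y (-(y - x))
    rw [norm_neg] at this
    simpa using this

theorem integrable_one_add_norm_pow_mul {m : ℕ} (φ : 𝓢(Eu m, ℂ)) (S : ℕ) :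
    Integrable (fun y : Eu m => (1 + ‖y‖) ^ S * ‖φ y‖) := by
  simp only [add_pow, one_pow, one_mul, Finset.sum_mul]
  refine integrable_finsetSum _ fun k _ => ?_
  refine ((SchwartzMap.integrable_pow_mul volume φ (S - k)).const_mul (S.choose k : ℝ)).congr
    (.of_forall fun y => ?_)
  dsimp only
  ring

/-- Away from the origin the kernel is comparable to (1+|y|)^s with s = -m - 2 Re β. Peetre's
inequality moves this weight to x at the cost of a power of 1 + |y - x|, which the Schwartz function
absorbs. -/
theorem exists_farPart_translate_le {m : ℕ} (hm : 1 ≤ m) (φ : 𝓢(Eu m, ℂ)) (S : ℕ) :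
    ∃ C : ℝ, 0 ≤ C ∧ ∀ β : ℂ, |-(m : ℝ) - 2 * β.re| ≤ S → ∀ x : Eu m,
      ‖farPart β (SchwartzMap.compSubConstCLM ℂ x φ)‖ ≤ C * (1 + ‖x‖) ^ (-(m : ℝ) - 2 * β.re) := by
  refine ⟨2 ^ S * ∫ y : Eu m, (1 + ‖y‖) ^ S * ‖φ y‖, by positivity, fun β hβ x => ?_⟩
  set s := -(m : ℝ) - 2 * β.re with hs
  have hre : (-(m : ℂ) - 2 * β).re = s := by simp [hs]
  have hms : MeasurableSet {y : Eu m | 1 < ‖y‖} := measurableSet_lt measurable_const measurable_norm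
  have hint : Integrable (fun y : Eu m => 2 ^ S * (1 + ‖x‖) ^ s *
      ((1 + ‖y - x‖) ^ S * ‖φ (y - x)‖)) :=
    ((integrable_one_add_norm_pow_mul φ S).comp_sub_right x).const_mul _
  have hx0 : 0 ≤ (1 + ‖x‖) ^ s := Real.rpow_nonneg (by positivity) _
  rw [farPart_eq_integral hm]
  refine (norm_integral_le_of_norm_le hint.integrableOn
    ((ae_restrict_iff' hms).2 (.of_forall fun y hy => ?_))).trans ?_
  · have hy1 : 1 < ‖y‖ := hy
    rw [norm_mul, Complex.norm_cpow_eq_rpow_re_of_pos (one_pos.trans hy1), hre]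
    -- As |y| > 1, the quantities |y| and 1 + |y| differ by a factor at most 2; the factor 2^S
    -- covers both signs of s.
    have h1 : ‖y‖ ^ s ≤ 2 ^ S * (1 + ‖y‖) ^ s := by
      rcases le_total 0 s with h | h
      · have h2 : ‖y‖ ^ s ≤ (1 + ‖y‖) ^ s := Real.rpow_le_rpow (norm_nonneg _) (by linarith) h
        have h3 : (1 : ℝ) ≤ 2 ^ S := one_le_pow₀ (by norm_num)
        have h4 : 0 ≤ (1 + ‖y‖) ^ s := Real.rpow_nonneg (by positivity) _
        nlinarith
      · have h2 : ‖y‖ ^ s ≤ ((1 + ‖y‖) / 2) ^ s :=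
          Real.rpow_le_rpow_of_nonpos (by positivity) (by linarith) h
        rw [Real.div_rpow (by positivity) (by norm_num), div_eq_mul_inv,
          ← Real.rpow_neg (by norm_num), mul_comm] at h2
        refine h2.trans ?_
        gcongr
        rw [← Real.rpow_natCast]
        exact Real.rpow_le_rpow_of_exponent_le (by norm_num) ((neg_le_abs s).trans hβ)
    change ‖y‖ ^ s * ‖φ (y - x)‖ ≤ _
    have h5 := one_add_norm_rpow_le x y hβ
    calc ‖y‖ ^ s * ‖φ (y - x)‖
        ≤ (2 ^ S * ((1 + ‖x‖) ^ s * (1 + ‖y - x‖) ^ S)) * ‖φ (y - x)‖ := by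
          gcongr
          exact h1.trans (by gcongr)
      _ = _ := by ring
  · refine (setIntegral_le_integral hint (.of_forall fun y => ?_)).trans_eq ?_
    · change 0 ≤ _
      positivity
    · rw [integral_const_mul, integral_sub_right_eq_self (fun y => (1 + ‖y‖) ^ S * ‖φ y‖) x]
      ring

/-- The near part decreases rapidly, so the rate is that of the kernel itself at infinity. -/
theorem exists_kernel_translate_le {m : ℕ} (hm : 1 ≤ m) (φ : 𝓢(Eu m, ℂ)) {β₀ : ℂ}
    (hβ₀ : ∀ n : ℕ, β₀ ≠ n) (ha : Admissible m β₀) :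
    ∃ C : ℝ, 0 ≤ C ∧ ∀ᶠ β in 𝓝 β₀, ∀ x : Eu m,
      ‖kernel m β (SchwartzMap.compSubConstCLM ℂ x φ)‖ ≤ C * (1 + ‖x‖) ^ (-(m : ℝ) - 2 * β.re) := by
  obtain ⟨N, hN⟩ := exists_nat_gt (2 * β₀.re + 1)
  -- `S` is both the exponent for Peetre's inequality and the decay order at which the near part
  -- becomes negligible.
  obtain ⟨S, hS⟩ := exists_nat_gt |-(m : ℝ) - 2 * β₀.re|
  obtain ⟨C₁, hC₁, h₁⟩ := exists_nearPart_translate_le φ hβ₀ hN S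
  obtain ⟨C₂, hC₂, h₂⟩ := exists_farPart_translate_le hm φ S
  have hc : ContinuousAt (fun β => ‖rieszConst m β‖) β₀ :=
    ((differentiableOn_rieszConst m).differentiableAt
      ((isOpen_setOf_admissible m).mem_nhds ha)).continuousAt.norm
  have hSo : IsOpen {β : ℂ | |-(m : ℝ) - 2 * β.re| < S} := isOpen_lt (by fun_prop) (by fun_prop)
  have hNo : IsOpen {β : ℂ | 2 * β.re + 1 < N} := isOpen_lt (by fun_prop) (by fun_prop)
  refine ⟨(‖rieszConst m β₀‖ + 1) * (C₁ + C₂), by positivity, ?_⟩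
  filter_upwards [h₁, hSo.mem_nhds hS, hNo.mem_nhds hN, isOpen_setOf_ne_natCast.mem_nhds hβ₀,
    hc.eventually_lt (g := fun _ => ‖rieszConst m β₀‖ + 1) continuousAt_const (by simp)]
    with β hβ1 hβS hβN hβn hβc x
  have hβS' : |-(m : ℝ) - 2 * β.re| < S := hβS
  have hβN' : 2 * β.re + 1 < N := hβN
  rw [kernel_apply hβn, radialPairing_eq_near_add_far hm (N := N) (by linarith), norm_mul, mul_assoc]
  refine mul_le_mul hβc.le ?_ (norm_nonneg _) (by positivity)
  rw [add_mul]
  refine (norm_add_le _ _).trans (add_le_add ((hβ1 x).trans ?_) (h₂ β hβS'.le x))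
  gcongr
  rw [← Real.rpow_natCast, ← Real.rpow_neg (by positivity)]
  exact Real.rpow_le_rpow_of_exponent_le (by linarith [norm_nonneg x])
    (by linarith [neg_abs_le (-(m : ℝ) - 2 * β.re)])

end RieszKernel

namespace RieszKernel

open MeasureTheory Set Filter Topology
open scoped SchwartzMap Laplacian FourierTransform

/-! ### Regularized kernels as Fourier transforms -/

theorem fourier_translate_apply {m : ℕ} (φ : 𝓢(Eu m, ℂ)) (x ξ : Eu m) :
    (𝓕 (SchwartzMap.compSubConstCLM ℂ x φ)) ξ =
      Complex.exp (((-2 * Real.pi * inner ℝ ξ x : ℝ) : ℂ) * Complex.I) * (𝓕 φ) ξ := by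
  rw [SchwartzMap.fourier_coe, SchwartzMap.fourier_coe, Real.fourier_eq', Real.fourier_eq',
    ← integral_const_mul, ← integral_add_right_eq_self _ x]
  congr 1
  ext v
  simp only [SchwartzMap.compSubConstCLM_apply, add_sub_cancel_right, smul_eq_mul, ← mul_assoc,
    ← Complex.exp_add]
  congr 2
  rw [inner_add_left, real_inner_comm ξ x]
  push_cast
  ring

/-- Translation by x multiplies φ̂(ξ) by e^(-2πi⟨ξ,x⟩), which turns the Fourier pairing into a
Fourier integral evaluated at x. -/
theorem kernel_translate_eq_fourier {m : ℕ} (hm : 1 ≤ m) {β : ℂ} (hβ : -(m : ℝ) / 2 < β.re)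
    (φ : 𝓢(Eu m, ℂ)) (x : Eu m) :
    kernel m β (SchwartzMap.compSubConstCLM ℂ x φ) =
      𝓕 (fun ξ : Eu m => symbol β ξ * (𝓕 φ) ξ) x := by
  rw [kernel_eq_fourierPairing hm hβ, fourierPairing, Real.fourier_eq']
  congr 1
  ext ξ
  rw [fourier_translate_apply, smul_eq_mul]
  ring

theorem norm_kernel_translate_le_of_re {m : ℕ} (hm : 1 ≤ m) {β : ℂ} (hβ : -(m : ℝ) / 2 < β.re)
    (φ : 𝓢(Eu m, ℂ)) (x : Eu m) :
    ‖kernel m β (SchwartzMap.compSubConstCLM ℂ x φ)‖ ≤ ∫ ξ : Eu m, ‖symbol β ξ * (𝓕 φ) ξ‖ := by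
  rw [kernel_translate_eq_fourier hm hβ, Real.fourier_eq']
  refine (norm_integral_le_integral_norm _).trans_eq ?_
  congr 1
  ext ξ
  rw [norm_smul, Complex.norm_exp_ofReal_mul_I, one_mul]

/-- If Re β > -m/2 the function is the Fourier transform of an integrable function, hence
continuous. Otherwise Re β < 0, and it is a multiple of a parameter integral. -/
theorem aestronglyMeasurable_kernel_translate {m : ℕ} (hm : 1 ≤ m) {β : ℂ} (φ : 𝓢(Eu m, ℂ)) :
    AEStronglyMeasurable (fun x : Eu m => kernel m β (SchwartzMap.compSubConstCLM ℂ x φ)) := by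
  have hm' : (0 : ℝ) < m := by exact_mod_cast hm
  by_cases hβ : -(m : ℝ) / 2 < β.re
  · simp only [kernel_translate_eq_fourier hm hβ]
    have := VectorFourier.fourierIntegral_continuous (L := innerₗ (Eu m))
      Real.continuous_fourierChar continuous_inner (integrable_symbol_mul hm hβ (𝓕 φ))
    exact this.aestronglyMeasurable
  · have hneg : β.re < 0 := by linarith
    have hn : ∀ n : ℕ, β ≠ n := by
      rintro n rfl
      rw [Complex.natCast_re] at hneg
      linarith [(Nat.cast_nonneg n : (0 : ℝ) ≤ n)]
    simp only [kernel_apply hn, radialPairing_eq_integral hm hneg]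
    refine AEStronglyMeasurable.const_mul ?_ _
    have h1 : Measurable (fun p : Eu m × Eu m => (‖p.2‖ : ℂ) ^ (-(m : ℂ) - 2 * β)) :=
      (measurable_norm_cpow _).comp measurable_snd
    have h2 : Continuous (fun p : Eu m × Eu m => φ (p.2 - p.1)) := by
      have := φ.continuous
      fun_prop
    exact (h1.mul h2.measurable).stronglyMeasurable.integral_prod_right.aestronglyMeasurable

/-! ### Convolvability -/

/-- The substitution x ↦ -x exchanges the two factors, and convolution of test functions is
commutative. -/
theorem IsConvolution.symm {m : ℕ} {S T W : 𝓢'(Eu m, ℂ)} (h : IsConvolution S T W) :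
    IsConvolution T S W := by
  intro φ ψ
  obtain ⟨h1, h2⟩ := h ψ φ
  have e : (fun x : Eu m => T (SchwartzMap.compSubConstCLM ℂ x φ) *
      S (SchwartzMap.compSubConstCLM ℂ (-x) ψ)) = fun x : Eu m => (fun y : Eu m =>
      S (SchwartzMap.compSubConstCLM ℂ y ψ) * T (SchwartzMap.compSubConstCLM ℂ (-y) φ)) (-x) := by
    ext x
    simp only [neg_neg]
    ring
  rw [e]
  refine ⟨h1.comp_neg, ?_⟩
  rw [integral_neg_eq_self (fun y : Eu m =>
      S (SchwartzMap.compSubConstCLM ℂ y ψ) * T (SchwartzMap.compSubConstCLM ℂ (-y) φ)), h2]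
  congr 1
  rw [← SchwartzMap.convolution_flip]
  congr 2
  ext
  simp

/-- Convolution of two kernels via the Fourier transform, if one of the regularizations is
integrable. -/
theorem integral_kernel_mul_kernel {m : ℕ} (hm : 1 ≤ m) {α β : ℂ} (hα : -(m : ℝ) / 2 < α.re)
    (hβ : -(m : ℝ) / 2 < β.re) (hαβ : -(m : ℝ) / 2 < (α + β).re) (φ ψ : 𝓢(Eu m, ℂ))
    (hint : Integrable (fun x : Eu m => kernel m β (SchwartzMap.compSubConstCLM ℂ (-x) ψ))) :
    Integrable (fun x : Eu m => kernel m α (SchwartzMap.compSubConstCLM ℂ x φ) *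
      kernel m β (SchwartzMap.compSubConstCLM ℂ (-x) ψ)) ∧
    ∫ x : Eu m, kernel m α (SchwartzMap.compSubConstCLM ℂ x φ) *
      kernel m β (SchwartzMap.compSubConstCLM ℂ (-x) ψ) =
      kernel m (α + β) (SchwartzMap.convolution (ContinuousLinearMap.mul ℂ ℂ) φ ψ) := by
  set g : Eu m → ℂ := fun ξ => symbol α ξ * (𝓕 φ) ξ with hg
  set h : Eu m → ℂ := fun ξ => symbol β ξ * (𝓕 ψ) ξ with hh
  have hgi : Integrable g := integrable_symbol_mul hm hα (𝓕 φ)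
  have hhi : Integrable h := integrable_symbol_mul hm hβ (𝓕 ψ)
  have hF (x : Eu m) : kernel m α (SchwartzMap.compSubConstCLM ℂ x φ) = 𝓕 g x :=
    kernel_translate_eq_fourier hm hα φ x
  have hG (x : Eu m) : kernel m β (SchwartzMap.compSubConstCLM ℂ (-x) ψ) = 𝓕⁻ h x := by
    rw [kernel_translate_eq_fourier hm hβ ψ, Real.fourierInv_eq_fourier_neg]
  have hGi : Integrable (𝓕⁻ h) := hint.congr (.of_forall hG)
  refine ⟨hint.bdd_mul (aestronglyMeasurable_kernel_translate hm φ)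
    (.of_forall fun x => norm_kernel_translate_le_of_re hm hα φ x), ?_⟩
  simp only [hF, hG]
  have hself : ∫ x : Eu m, (𝓕 g) x • (𝓕⁻ h) x = ∫ ξ : Eu m, g ξ • (𝓕 (𝓕⁻ h)) ξ := by
    simpa using! (VectorFourier.integral_fourierIntegral_smul_eq_flip (L := innerₗ (Eu m))
      Real.continuous_fourierChar continuous_inner hgi hGi)
  simp only [smul_eq_mul] at hself
  rw [hself, kernel_eq_fourierPairing hm hαβ, fourierPairing]
  refine integral_congr_ae ?_
  filter_upwards [ae_ne_zero hm] with ξ hξ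
  have hhF : Integrable (𝓕 h) := by
    have e : 𝓕 h = fun x => 𝓕⁻ h (-x) := by
      ext x; rw [Real.fourierInv_eq_fourier_neg, neg_neg]
    rw [e]
    exact hGi.comp_neg
  -- The symbol is only known to be continuous off the origin, so pointwise inversion is used for ξ
  -- ≠ 0, which suffices almost everywhere.
  rw [hhi.fourier_fourierInv_eq hhF ((continuousAt_symbol β hξ).mul (𝓕 ψ).continuous.continuousAt),
    SchwartzMap.fourier_convolution, SchwartzMap.pairing_apply_apply, symbol_add α β hξ]
  simp only [hg, hh, ContinuousLinearMap.mul_apply']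
  ring

theorem finrank_Eu (m : ℕ) : (Module.finrank ℝ (Eu m) : ℝ) = m := by simp

theorem integrable_one_add_norm_rpow {m : ℕ} {s : ℝ} (hs : s < -m) :
    Integrable (fun x : Eu m => (1 + ‖x‖) ^ s) := by
  have := integrable_one_add_norm (E := Eu m) (μ := volume) (r := -s)
    (by rw [finrank_Eu]; linarith)
  simpa using this

/-- The convolution with a kernel whose regularization decays at a known rate, by analytic
continuation in the second exponent. -/
theorem isConvolution_of_decay {m : ℕ} (hm : 1 ≤ m) {α : ℂ} (hα : -(m : ℝ) / 2 < α.re) {A : ℝ}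
    (hdecay : ∀ φ : 𝓢(Eu m, ℂ), ∃ C : ℝ, ∀ x : Eu m,
      ‖kernel m α (SchwartzMap.compSubConstCLM ℂ x φ)‖ ≤ C * (1 + ‖x‖) ^ (-(m : ℝ) - 2 * A))
    (hadm : ∀ β : ℂ, -(m : ℝ) / 2 - A < β.re → Admissible m β → Admissible m (α + β))
    {β : ℂ} (hβ : -(m : ℝ) / 2 - A < β.re) (hβa : Admissible m β) (hβn : ∀ n : ℕ, β ≠ n) :
    IsConvolution (kernel m α) (kernel m β) (kernel m (α + β)) := by
  intro φ ψ
  have hm' : (0 : ℝ) < m := by exact_mod_cast hm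
  obtain ⟨C, hC⟩ := hdecay φ
  set D : Set ℂ := {z : ℂ | -(m : ℝ) / 2 - A < z.re} ∩
    ({z : ℂ | Admissible m z} ∩ {z : ℂ | ∀ n : ℕ, z ≠ n}) with hD
  have hDo : IsOpen D := (isOpen_lt (by fun_prop) (by fun_prop)).inter
    ((isOpen_setOf_admissible m).inter isOpen_setOf_ne_natCast)
  have hDc : IsPreconnected D := by
    have : D = {z : ℂ | -(m : ℝ) / 2 - A < z.re} \
        ({z : ℂ | ¬ Admissible m z} ∪ {z : ℂ | ¬ ∀ n : ℕ, z ≠ n}) := by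
      ext z; simp [D]
    rw [this]
    exact isPreconnected_halfPlane_diff_countable _
      ((countable_setOf_not_admissible m).union countable_setOf_natCast)
  set f : ℂ → Eu m → ℂ := fun z x => kernel m α (SchwartzMap.compSubConstCLM ℂ x φ) *
    kernel m z (SchwartzMap.compSubConstCLM ℂ (-x) ψ) with hf
  have hGm (z : ℂ) : AEStronglyMeasurable
      (fun x : Eu m => kernel m z (SchwartzMap.compSubConstCLM ℂ (-x) ψ)) :=
    (aestronglyMeasurable_kernel_translate hm ψ).comp_quasiMeasurePreserving
      (Measure.measurePreserving_neg _).quasiMeasurePreserving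
  have hfm (z : ℂ) : AEStronglyMeasurable (f z) :=
    (aestronglyMeasurable_kernel_translate hm φ).mul (hGm z)
  have hdom : ∀ z₀ ∈ D, ∃ r > 0, ∃ g : Eu m → ℝ, Integrable g ∧
      ∀ᵐ x : Eu m, ∀ z ∈ Metric.ball z₀ r, ‖f z x‖ ≤ g x := by
    intro z₀ hz₀
    have hz₀' : -(m : ℝ) / 2 - A < z₀.re := hz₀.1
    obtain ⟨C', hC'0, hC'⟩ := exists_kernel_translate_le hm ψ hz₀.2.2 hz₀.2.1
    obtain ⟨r₁, hr₁, hball⟩ := Metric.eventually_nhds_iff_ball.1 hC'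
    obtain ⟨ε, hε, hεm⟩ : ∃ ε > 0, -(m : ℝ) / 2 - A < z₀.re - ε :=
      ⟨(z₀.re + m / 2 + A) / 2, by linarith, by linarith⟩
    -- The sum of the two decay exponents is below -m exactly when Re z₀ - ε > -m/2 - A, which is
    -- how ε was chosen.
    refine ⟨min r₁ ε, lt_min hr₁ hε, fun x => C * C' *
      (1 + ‖x‖) ^ (-(m : ℝ) - 2 * A + (-(m : ℝ) - 2 * (z₀.re - ε))),
      (integrable_one_add_norm_rpow (by linarith)).const_mul _, .of_forall fun x z hz => ?_⟩
    have h1 := hball z (Metric.ball_subset_ball (min_le_left _ _) hz) (-x)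
    rw [norm_neg] at h1
    have hb : |(z - z₀).re| < ε := (Complex.abs_re_le_norm _).trans_lt (by
      rw [← dist_eq_norm]; exact lt_of_lt_of_le hz (min_le_right _ _))
    rw [Complex.sub_re, abs_lt] at hb
    have hx : 1 ≤ 1 + ‖x‖ := by linarith [norm_nonneg x]
    have h2 : (1 + ‖x‖) ^ (-(m : ℝ) - 2 * z.re) ≤ (1 + ‖x‖) ^ (-(m : ℝ) - 2 * (z₀.re - ε)) :=
      Real.rpow_le_rpow_of_exponent_le hx (by linarith)
    beta_reduce
    rw [norm_mul, Real.rpow_add (by linarith)]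
    calc _ ≤ (C * (1 + ‖x‖) ^ (-(m : ℝ) - 2 * A)) *
          (C' * (1 + ‖x‖) ^ (-(m : ℝ) - 2 * (z₀.re - ε))) := by
          refine mul_le_mul (hC x) (h1.trans (by gcongr)) (norm_nonneg _)
            ((norm_nonneg _).trans (hC x))
      _ = _ := by ring
  have hβD : β ∈ D := ⟨hβ, hβa, hβn⟩
  have hint : Integrable (f β) := by
    obtain ⟨r, hr, g, hg, hb⟩ := hdom β hβD
    refine hg.mono' (hfm β) ?_
    filter_upwards [hb] with x hx using hx β (Metric.mem_ball_self hr)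
  refine ⟨hint, ?_⟩
  have hL : DifferentiableOn ℂ (fun z => ∫ x, f z x) D := by
    refine differentiableOn_integral_of_locally_dominated hDo (fun z _ => hfm z)
      (.of_forall fun x => ?_) hdom
    exact ((differentiableOn_kernel hm _).mono fun z hz => hz.2.1).const_mul _
  have hR : DifferentiableOn ℂ (fun z => kernel m (α + z)
      (SchwartzMap.convolution (ContinuousLinearMap.mul ℂ ℂ) φ ψ)) D :=
    (differentiableOn_kernel hm _).comp (by fun_prop) fun z hz => hadm z hz.1 hz.2.1
  -- For Re z > 0 the second regularization is O((1+|x|)^(-m-2 Re z)), hence integrable, and the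
  -- Fourier computation applies there.
  refine eqOn_of_differentiableOn_of_eqOn_open hDo hDc hL hR (V := {z : ℂ | 0 < z.re})
    (isOpen_lt (by fun_prop) (by fun_prop)) ?_ ?_ hβD
  -- The imaginary part keeps the witness away from the natural numbers.
  · refine ⟨(|A| + 1 : ℝ) + Complex.I, ⟨?_, admissible_of_re ?_, fun n hn => ?_⟩, ?_⟩
    · simp; linarith [neg_abs_le A]
    · simp; linarith [abs_nonneg A]
    · have := congrArg Complex.im hn
      simp at this
    · simp; linarith [abs_nonneg A]
  · rintro z ⟨hz, hz0⟩
    have hz0' : 0 < z.re := hz0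
    refine (integral_kernel_mul_kernel hm hα (by linarith) (by rw [Complex.add_re]; linarith)
      φ ψ ?_).2
    obtain ⟨C', hC'0, hC'⟩ := exists_kernel_translate_le hm ψ hz.2.2 hz.2.1
    refine ((integrable_one_add_norm_rpow (m := m) (s := -(m : ℝ) - 2 * z.re)
      (by linarith)).const_mul C').mono' (hGm z) (.of_forall fun x => ?_)
    have := hC'.self_of_nhds (-x)
    rwa [norm_neg] at this

/-! ### Kernels with natural exponents -/

theorem kernel_natCast_translate {m : ℕ} (hm : 1 ≤ m) (k : ℕ) (φ : 𝓢(Eu m, ℂ)) (x : Eu m) :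
    kernel m k (SchwartzMap.compSubConstCLM ℂ x φ) =
      (fun χ : 𝓢(Eu m, ℂ) => -Δ χ)^[k] φ (-x) := by
  have hm' : (0 : ℝ) < m := by exact_mod_cast hm
  rw [kernel_translate_eq_fourier hm (by
    rw [Complex.natCast_re]; linarith [(Nat.cast_nonneg k : (0 : ℝ) ≤ k)])]
  simp only [← fourier_iterate_neg_laplacian_apply]
  set χ := (fun χ : 𝓢(Eu m, ℂ) => -Δ χ)^[k] φ
  have h : (𝓕⁻ (𝓕 χ)) (-x) = χ (-x) := by rw [FourierTransform.fourierInv_fourier_eq]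
  rw [← h, SchwartzMap.fourierInv_coe, Real.fourierInv_eq_fourier_neg, neg_neg]

/-- Since the regularization is a Schwartz function, `s` is arbitrary. This lets the continuation in
β reach any half-plane. -/
theorem exists_kernel_natCast_translate_le {m : ℕ} (hm : 1 ≤ m) (k : ℕ) (s : ℝ) (φ : 𝓢(Eu m, ℂ)) :
    ∃ C : ℝ, ∀ x : Eu m,
      ‖kernel m k (SchwartzMap.compSubConstCLM ℂ x φ)‖ ≤ C * (1 + ‖x‖) ^ s := by
  set χ := (fun χ : 𝓢(Eu m, ℂ) => -Δ χ)^[k] φ with hχ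
  obtain ⟨M, hM⟩ := exists_nat_gt (-s)
  refine ⟨2 ^ M * (Finset.Iic (M, 0)).sup (fun p => SchwartzMap.seminorm ℂ p.1 p.2) χ,
    fun x => ?_⟩
  have h := SchwartzMap.one_add_le_sup_seminorm_apply (𝕜 := ℂ) (m := (M, 0)) le_rfl le_rfl χ (-x)
  rw [norm_neg, norm_iteratedFDeriv_zero] at h
  rw [kernel_natCast_translate hm, ← hχ]
  have hx : 1 ≤ 1 + ‖x‖ := by linarith [norm_nonneg x]
  have hp : 0 < (1 + ‖x‖) ^ M := by positivity
  have h1 : ((1 + ‖x‖) ^ M)⁻¹ ≤ (1 + ‖x‖) ^ s := by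
    rw [← Real.rpow_natCast, ← Real.rpow_neg (by positivity)]
    exact Real.rpow_le_rpow_of_exponent_le hx (by linarith)
  calc ‖χ (-x)‖ = ((1 + ‖x‖) ^ M * ‖χ (-x)‖) * ((1 + ‖x‖) ^ M)⁻¹ := by field_simp
    _ ≤ _ := by gcongr

theorem isConvolution_natCast_left {m : ℕ} (hm : 1 ≤ m) (k : ℕ) {β : ℂ} (hβ : Admissible m β) :
    IsConvolution (kernel m k) (kernel m β) (kernel m (k + β)) := by
  have hm' : (0 : ℝ) < m := by exact_mod_cast hm
  have hk : -(m : ℝ) / 2 < (k : ℂ).re := by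
    rw [Complex.natCast_re]; linarith [(Nat.cast_nonneg k : (0 : ℝ) ≤ k)]
  by_cases hn : ∀ n : ℕ, β ≠ n
  -- Any rate is available; this one gives -m/2 - A < Re β.
  · exact isConvolution_of_decay hm hk (A := |β.re|)
      (exists_kernel_natCast_translate_le hm k _) (fun z _ hz => hz.natCast_add k)
      (by linarith [neg_abs_le β.re]) hβ hn
  · push Not at hn
    obtain ⟨n, rfl⟩ := hn
    intro φ ψ
    have hn' : -(m : ℝ) / 2 < (n : ℂ).re := by
      rw [Complex.natCast_re]; linarith [(Nat.cast_nonneg n : (0 : ℝ) ≤ n)]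
    refine integral_kernel_mul_kernel hm hk hn' ?_ φ ψ ?_
    · rw [Complex.natCast_re] at hk
      rw [Complex.add_re, Complex.natCast_re, Complex.natCast_re]
      linarith [(Nat.cast_nonneg n : (0 : ℝ) ≤ n)]
    · simp only [kernel_natCast_translate hm, neg_neg]
      exact SchwartzMap.integrable _

/-- For non-natural exponents, Re(α+β) > -m/2 forces at least one of Re α, Re β to exceed -m/2. By
symmetry that one can serve as the fixed factor, whose decay rate `A` is its own real part. -/
theorem isConvolution_kernel {m : ℕ} (hm : 1 ≤ m) {α β : ℂ} (hα : Admissible m α)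
    (hβ : Admissible m β)
    (h : -(m : ℝ) / 2 < (α + β).re ∨ (∃ k : ℕ, α = k) ∨ (∃ k : ℕ, β = k)) :
    IsConvolution (kernel m α) (kernel m β) (kernel m (α + β)) := by
  have hm' : (0 : ℝ) < m := by exact_mod_cast hm
  by_cases hαn : ∀ k : ℕ, α ≠ k
  swap
  · push Not at hαn
    obtain ⟨k, rfl⟩ := hαn
    exact isConvolution_natCast_left hm k hβ
  by_cases hβn : ∀ k : ℕ, β ≠ k
  swap
  · push Not at hβn
    obtain ⟨k, rfl⟩ := hβn
    rw [add_comm]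
    exact (isConvolution_natCast_left hm k hα).symm
  have hre : -(m : ℝ) / 2 < (α + β).re := by
    rcases h with h | ⟨k, hk⟩ | ⟨k, hk⟩
    exacts [h, absurd hk (hαn k), absurd hk (hβn k)]
  have key {a b : ℂ} (ha : Admissible m a) (hb : Admissible m b) (han : ∀ n : ℕ, a ≠ n)
      (hbn : ∀ n : ℕ, b ≠ n) (hab : -(m : ℝ) / 2 < (a + b).re) (hare : -(m : ℝ) / 2 < a.re) :
      IsConvolution (kernel m a) (kernel m b) (kernel m (a + b)) := by
    rw [Complex.add_re] at hab
    refine isConvolution_of_decay hm hare (A := a.re) (fun φ => ?_)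
      (fun z hz _ => admissible_of_re (by rw [Complex.add_re]; linarith)) (by linarith) hb hbn
    obtain ⟨C, -, hC⟩ := exists_kernel_translate_le hm φ han ha
    exact ⟨C, hC.self_of_nhds⟩
  by_cases hare : -(m : ℝ) / 2 < α.re
  · exact key hα hβ hαn hβn hre hare
  · have hbre : -(m : ℝ) / 2 < β.re := by
      rw [Complex.add_re] at hre
      linarith
    have := (key hβ hα hβn hαn (by rwa [add_comm]) hbre).symm
    rwa [add_comm β α] at this

end RieszKernel

namespace RieszKernel

open MeasureTheory Set Filter Topology
open scoped SchwartzMap Laplacian FourierTransform ContDiff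

/-! ### Failure of convolvability -/

/-- There is a non-negative test function supported in the closed unit ball. -/
theorem exists_nonneg_schwartzMap (m : ℕ) : ∃ (φ : 𝓢(Eu m, ℂ)) (b : Eu m → ℝ),
    (∀ y, φ y = b y) ∧ (∀ y, 0 ≤ b y) ∧ Integrable b ∧ 0 < ∫ y, b y ∧
      tsupport φ ⊆ Metric.closedBall 0 1 := by
  let b : ContDiffBump (0 : Eu m) := ⟨1 / 2, 1, by norm_num, by norm_num⟩
  have h1 : HasCompactSupport (fun y : Eu m => (b y : ℂ)) :=
    b.hasCompactSupport.comp_left (g := ((↑) : ℝ → ℂ)) Complex.ofReal_zero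
  have h2 : ContDiff ℝ ∞ (fun y : Eu m => (b y : ℂ)) :=
    Complex.ofRealCLM.contDiff.comp b.contDiff
  refine ⟨h1.toSchwartzMap h2, b, fun y => rfl, fun y => b.nonneg, b.integrable, b.integral_pos, ?_⟩
  have h3 : tsupport (fun y : Eu m => (b y : ℂ)) ⊆ tsupport b :=
    closure_mono fun y hy => by
      simp only [Function.mem_support] at hy ⊢
      exact fun h => hy (by rw [h, Complex.ofReal_zero])
  exact h3.trans b.tsupport_eq.subset

theorem rayDeriv_translate_eq_zero {m : ℕ} {φ : 𝓢(Eu m, ℂ)}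
    (hφ : tsupport φ ⊆ Metric.closedBall 0 1) {x : Eu m} (hx : 2 < ‖x‖) (k : ℕ) {r : ℝ}
    (hr : r ∈ Icc (0 : ℝ) 1) : rayDeriv k (SchwartzMap.compSubConstCLM ℂ x φ) r = 0 := by
  have h (v : Metric.sphere (0 : Eu m) 1) : iteratedDeriv k (fun t : ℝ =>
      SchwartzMap.compSubConstCLM ℂ x φ (t • (v : Eu m))) r = 0 := by
    rw [iteratedDeriv_ray]
    have e : (SchwartzMap.compSubConstCLM ℂ x φ : Eu m → ℂ) = fun y => φ (y - x) := rfl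
    rw [e, iteratedFDeriv_comp_sub]
    have hn : ‖r • (v : Eu m)‖ ≤ 1 := by
      rw [norm_smul, norm_eq_of_mem_sphere, mul_one, Real.norm_of_nonneg hr.1]; exact hr.2
    have h1 : 1 < ‖r • (v : Eu m) - x‖ := by
      have := norm_sub_norm_le x (r • (v : Eu m))
      rw [norm_sub_rev] at this
      linarith
    have h2 : r • (v : Eu m) - x ∉ Function.support (iteratedFDeriv ℝ k φ) := fun h3 => by
      have := hφ (support_iteratedFDeriv_subset k h3)
      rw [mem_closedBall_zero_iff] at this
      linarith
    rw [Function.notMem_support.1 h2]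
    rfl
  exact (integral_congr_ae (.of_forall h)).trans (integral_zero _ _)

/-- For |x| > 2 the translate vanishes on the unit ball, so the Taylor terms drop out and the finite
part is an ordinary integral for every β. -/
theorem radialPairing_translate_eq {m : ℕ} (hm : 1 ≤ m) {φ : 𝓢(Eu m, ℂ)}
    (hφ : tsupport φ ⊆ Metric.closedBall 0 1) {x : Eu m} (hx : 2 < ‖x‖) (β : ℂ) :
    radialPairing (-(m : ℂ) - 2 * β) (SchwartzMap.compSubConstCLM ℂ x φ) =
      ∫ u : Eu m, (‖u + x‖ : ℂ) ^ (-(m : ℂ) - 2 * β) * φ u := by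
  obtain ⟨N, hN⟩ := exists_nat_gt (2 * β.re)
  have hr0 := rayDeriv_translate_eq_zero hφ hx
  have hnear : nearPart N β (SchwartzMap.compSubConstCLM ℂ x φ) = 0 := by
    rw [nearPart, setIntegral_eq_zero_of_forall_eq_zero, zero_add]
    · exact Finset.sum_eq_zero fun k _ => by simp [hr0 k (r := 0) (by simp)]
    · intro r hr
      simp [rayRem, hr0 _ (Ioc_subset_Icc_self hr), hr0 _ (r := 0) (by simp)]
  rw [radialPairing_eq_near_add_far hm hN, hnear, zero_add, farPart_eq_integral hm,
    setIntegral_eq_integral_of_forall_compl_eq_zero, ← integral_add_right_eq_self _ x]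
  · simp
  · intro y hy
    have hy' : ‖y‖ ≤ 1 := by simpa using hy
    have : y - x ∉ tsupport φ := fun h => by
      have h1 := hφ h
      rw [mem_closedBall_zero_iff] at h1
      have := norm_sub_norm_le x y
      rw [norm_sub_rev] at this
      linarith
    rw [SchwartzMap.compSubConstCLM_apply, image_eq_zero_of_notMem_tsupport this, mul_zero]

/-- On the support of φ the ratio |u+x|/|x| tends to 1 uniformly as |x| → ∞, so the integral is
|x|^z (∫ φ + error) with error at most half of ∫ φ. Non-negativity of `φ` makes ∫ |φ| equal to ∫ φ,
so half of the main term survives. -/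
theorem exists_le_norm_kernel_translate {m : ℕ} (hm : 1 ≤ m) {β : ℂ} (hβ : ∀ n : ℕ, β ≠ n)
    (ha : Admissible m β) {φ : 𝓢(Eu m, ℂ)} {b : Eu m → ℝ} (hb : ∀ y, φ y = b y)
    (hb0 : ∀ y, 0 ≤ b y) (hbi : Integrable b) (hbpos : 0 < ∫ y, b y)
    (hφ : tsupport φ ⊆ Metric.closedBall 0 1) :
    ∃ c > 0, ∃ R : ℝ, ∀ x : Eu m, R < ‖x‖ → c * ‖x‖ ^ (-(m : ℝ) - 2 * β.re) ≤
      ‖kernel m β (SchwartzMap.compSubConstCLM ℂ x φ)‖ := by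
  set z : ℂ := -(m : ℂ) - 2 * β with hz
  have hzre : z.re = -(m : ℝ) - 2 * β.re := by simp [hz]
  obtain ⟨δ, hδ, hδz⟩ : ∃ δ > 0, ∀ ρ : ℝ, |ρ - 1| < δ → ‖(ρ : ℂ) ^ z - 1‖ < 1 / 2 := by
    have hc : ContinuousAt (fun ρ : ℝ => (ρ : ℂ) ^ z) 1 :=
      Complex.continuousAt_ofReal_cpow_const 1 z (Or.inr one_ne_zero)
    obtain ⟨δ, hδ, h⟩ := Metric.continuousAt_iff.1 hc (1 / 2) (by norm_num)
    refine ⟨δ, hδ, fun ρ hρ => ?_⟩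
    have := h (x := ρ) (by rwa [Real.dist_eq])
    simpa [dist_eq_norm] using this
  -- |x| > 2 separates the support from the unit ball, and |x| > 1/δ puts |u+x|/|x| within δ of 1
  -- when |u| ≤ 1.
  refine ⟨‖rieszConst m β‖ * ((1 / 2) * ∫ y, b y), by
    have := norm_pos_iff.2 (rieszConst_ne_zero hβ ha); positivity, max 2 δ⁻¹, fun x hx => ?_⟩
  have hx2 : 2 < ‖x‖ := (le_max_left _ _).trans_lt hx
  have hxδ : δ⁻¹ < ‖x‖ := (le_max_right _ _).trans_lt hx
  have hx0 : 0 < ‖x‖ := by linarith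
  set w : Eu m → ℂ := fun u => ((‖u + x‖ / ‖x‖ : ℝ) : ℂ) ^ z with hw
  have hbw (u : Eu m) : ‖(w u - 1) * φ u‖ ≤ (1 / 2) * b u := by
    rw [norm_mul, hb, Complex.norm_real, Real.norm_of_nonneg (hb0 u)]
    by_cases hu : u ∈ tsupport φ
    · have hu1 : ‖u‖ ≤ 1 := by simpa using hφ hu
      refine mul_le_mul_of_nonneg_right (hδz _ ?_).le (hb0 u)
      have h1 : |‖u + x‖ - ‖x‖| ≤ 1 := by
        refine (abs_norm_sub_norm_le _ _).trans ?_
        rwa [add_sub_cancel_right]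
      rw [div_sub_one hx0.ne', abs_div, abs_of_pos hx0, div_lt_iff₀ hx0]
      refine h1.trans_lt ?_
      rwa [inv_lt_iff_one_lt_mul₀' hδ] at hxδ
    · have := image_eq_zero_of_notMem_tsupport hu
      rw [hb] at this
      rw [Complex.ofReal_eq_zero.1 this]
      simp
  have hwm : Measurable w :=
    (Complex.measurable_ofReal.comp ((by fun_prop : Measurable fun u : Eu m => ‖u + x‖).div_const _)
      ).pow_const z
  have hi1 : Integrable (fun u => (w u - 1) * φ u) :=
    (hbi.const_mul (1 / 2)).mono'
      ((hwm.sub_const 1).mul φ.continuous.measurable).aestronglyMeasurable (.of_forall hbw)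
  have hφint : ∫ u, φ u = ((∫ u, b u : ℝ) : ℂ) := by
    simp only [hb]
    exact integral_ofReal
  have hsplit : ∫ u : Eu m, (‖u + x‖ : ℂ) ^ z * φ u =
      (‖x‖ : ℂ) ^ z * ((∫ u, φ u) + ∫ u, (w u - 1) * φ u) := by
    rw [← integral_add φ.integrable hi1, ← integral_const_mul]
    congr 1
    ext u
    have e : (‖u + x‖ : ℂ) ^ z = (‖x‖ : ℂ) ^ z * w u := by
      simp only [hw]
      rw [← Complex.mul_cpow_ofReal_nonneg hx0.le (by positivity), ← Complex.ofReal_mul,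
        mul_div_cancel₀ _ hx0.ne']
    rw [e]
    ring
  have hlow : (1 / 2) * ∫ u, b u ≤ ‖(∫ u, φ u) + ∫ u, (w u - 1) * φ u‖ := by
    have h1 := norm_integral_le_of_norm_le (hbi.const_mul (1 / 2)) (.of_forall hbw)
    rw [integral_const_mul] at h1
    have h2 : ‖∫ u, φ u‖ = ∫ u, b u := by
      rw [hφint, Complex.norm_real, Real.norm_of_nonneg hbpos.le]
    have h3 (P Q : ℂ) (B : ℝ) (hP : ‖P‖ = B) (hQ : ‖Q‖ ≤ 1 / 2 * B) : 1 / 2 * B ≤ ‖P + Q‖ := by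
      have := norm_sub_le (P + Q) Q
      rw [add_sub_cancel_right] at this
      linarith
    exact h3 _ _ _ h2 h1
  rw [kernel_apply hβ, radialPairing_translate_eq hm hφ hx2, hsplit, norm_mul, norm_mul,
    Complex.norm_cpow_eq_rpow_re_of_pos hx0, hzre, mul_assoc]
  refine mul_le_mul_of_nonneg_left ?_ (norm_nonneg _)
  rw [mul_comm]
  exact mul_le_mul_of_nonneg_left hlow (by positivity)

/-- In polar coordinates this is the divergence of ∫ dr/r at infinity. It settles the borderline
case Re(α+β) = -m/2 as well. -/
theorem not_integrable_indicator_norm_rpow {m : ℕ} (hm : 1 ≤ m) {R : ℝ} (hR : 0 < R) :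
    ¬ Integrable (fun x : Eu m => (Ioi R).indicator (fun r : ℝ => r ^ (-(m : ℝ))) ‖x‖) := by
  have : Nonempty (Fin m) := ⟨⟨0, hm⟩⟩
  rw [integrable_fun_norm_addHaar volume (f := (Ioi R).indicator (fun r : ℝ => r ^ (-(m : ℝ))))]
  intro h
  refine not_integrableOn_Ioi_inv (a := R) ?_
  refine (h.mono_set (Ioi_subset_Ioi hR.le)).congr_fun (fun r hr => ?_) measurableSet_Ioi
  have hr0 : 0 < r := hR.trans hr
  simp only [indicator_of_mem hr, finrank_euclideanSpace, Fintype.card_fin, smul_eq_mul]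
  rw [← Real.rpow_natCast, ← Real.rpow_add hr0, Nat.cast_sub hm, ← Real.rpow_neg_one]
  congr 1
  push_cast
  ring

/-- On one bump function the product of the regularizations is at least a constant times |x|^(-2m-2
Re(α+β)), hence at least a constant times |x|^(-m) when the inequality fails. Natural exponents have
to be excluded: their regularizations of a bump have compact support. -/
theorem re_add_gt_of_isConvolution {m : ℕ} (hm : 1 ≤ m) {α β : ℂ} (hα : ∀ n : ℕ, α ≠ n)
    (hαa : Admissible m α) (hβ : ∀ n : ℕ, β ≠ n) (hβa : Admissible m β) {V : 𝓢'(Eu m, ℂ)}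
    (h : IsConvolution (kernel m α) (kernel m β) V) : -(m : ℝ) / 2 < (α + β).re := by
  by_contra! hre
  rw [Complex.add_re] at hre
  obtain ⟨φ, b, hb, hb0, hbi, hbpos, hφ⟩ := exists_nonneg_schwartzMap m
  obtain ⟨c₁, hc₁, R₁, h₁⟩ := exists_le_norm_kernel_translate hm hα hαa hb hb0 hbi hbpos hφ
  obtain ⟨c₂, hc₂, R₂, h₂⟩ := exists_le_norm_kernel_translate hm hβ hβa hb hb0 hbi hbpos hφ
  set R := max 1 (max R₁ R₂) with hR
  have hR1 : 1 ≤ R := le_max_left _ _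
  refine not_integrable_indicator_norm_rpow hm (R := R) (by linarith) ?_
  refine ((h φ φ).1.norm.const_mul (c₁ * c₂)⁻¹).mono' ?_ (.of_forall fun x => ?_)
  · exact (((by fun_prop : Measurable fun r : ℝ => r ^ (-(m : ℝ))).indicator
      measurableSet_Ioi).comp measurable_norm).aestronglyMeasurable
  · by_cases hx : ‖x‖ ∈ Ioi R
    · have hxR : R < ‖x‖ := hx
      have hx0 : 0 < ‖x‖ := by linarith
      have e1 := h₁ x (((le_max_left _ _).trans (le_max_right _ _)).trans_lt hxR)
      have e2 := h₂ (-x) (by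
        rw [norm_neg]; exact ((le_max_right _ _).trans (le_max_right _ _)).trans_lt hxR)
      rw [norm_neg] at e2
      rw [indicator_of_mem hx, Real.norm_of_nonneg (by positivity), norm_mul,
        ← div_eq_inv_mul, le_div_iff₀ (by positivity)]
      have e3 : ‖x‖ ^ (-(m : ℝ)) ≤
          ‖x‖ ^ (-(m : ℝ) - 2 * α.re) * ‖x‖ ^ (-(m : ℝ) - 2 * β.re) := by
        rw [← Real.rpow_add hx0]
        exact Real.rpow_le_rpow_of_exponent_le (by linarith) (by linarith)
      calc ‖x‖ ^ (-(m : ℝ)) * (c₁ * c₂)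
          ≤ (‖x‖ ^ (-(m : ℝ) - 2 * α.re) * ‖x‖ ^ (-(m : ℝ) - 2 * β.re)) * (c₁ * c₂) := by gcongr
        _ = (c₁ * ‖x‖ ^ (-(m : ℝ) - 2 * α.re)) * (c₂ * ‖x‖ ^ (-(m : ℝ) - 2 * β.re)) := by ring
        _ ≤ _ := by gcongr
    · rw [indicator_of_notMem hx, norm_zero]
      positivity

/-! ### The analytic continuation -/

/-- The last clause is where necessity of the convergence condition enters: a convolvable pair has a
natural exponent or satisfies Re(α+β) > -m/2, and there the identity is already known. -/
theorem isContinuedConvolution_kernel {m : ℕ} (hm : 1 ≤ m) :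
    IsContinuedConvolution (admissiblePairs m) (kernel m) (kernel m)
      (fun α β => kernel m (α + β)) where
  isOpen := isOpen_admissiblePairs m
  isConnected := isConnected_admissiblePairs m hm
  holomorphic φ := (differentiableOn_kernel hm φ).comp (f := fun p : ℂ × ℂ => p.1 + p.2)
    (by fun_prop) fun p hp => hp.2.2
  convolvable := by
    have hm' : (0 : ℝ) < m := by exact_mod_cast hm
    refine ⟨admissiblePairs m ∩ {p | -(m : ℝ) / 2 < (p.1 + p.2).re}, inter_subset_left,
      (isOpen_admissiblePairs m).inter (isOpen_lt (by fun_prop) (by fun_prop)),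
      ⟨(0, 0), ⟨?_, ?_, ?_⟩, ?_⟩, ?_⟩
    · exact admissible_of_re (by simp; linarith)
    · exact admissible_of_re (by simp; linarith)
    · exact admissible_of_re (by simp; linarith)
    · simp; linarith
    · exact fun p hp => ⟨_, isConvolution_kernel hm hp.1.1 hp.1.2.1 (Or.inl hp.2)⟩
  extends_convolution := by
    rintro ⟨α, β⟩ ⟨hα, hβ, -⟩ ⟨V, hV⟩
    refine isConvolution_kernel hm hα hβ ?_
    by_cases hαn : ∀ k : ℕ, α ≠ k
    swap
    · push Not at hαn
      exact Or.inr (Or.inl hαn)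
    by_cases hβn : ∀ k : ℕ, β ≠ k
    swap
    · push Not at hβn
      exact Or.inr (Or.inr hβn)
    exact Or.inl (re_add_gt_of_isConvolution hm hαn hα hβn hβ hV)

end RieszKernel

theorem proposition6p1 (m : ℕ) (hm : 1 ≤ m) :
    (∀ α β : ℂ, RieszKernel.Admissible m α → RieszKernel.Admissible m β →
      RieszKernel.Admissible m (α + β) →
      (-(m : ℝ) / 2 < (α + β).re ∨ (∃ k : ℕ, α = k) ∨ (∃ k : ℕ, β = k)) →
      RieszKernel.IsConvolution (RieszKernel.kernel m α) (RieszKernel.kernel m β)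
        (RieszKernel.kernel m (α + β))) ∧
    RieszKernel.IsContinuedConvolution (RieszKernel.admissiblePairs m)
      (RieszKernel.kernel m) (RieszKernel.kernel m)
      (fun α β => RieszKernel.kernel m (α + β)) :=
  ⟨fun _ _ hα hβ _ h => RieszKernel.isConvolution_kernel hm hα hβ h,
    RieszKernel.isContinuedConvolution_kernel hm⟩
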